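/- Let $d=2^L$ with $L\ge 1$, let $p^*$ be a probability density on the finite set $[n_1]\times\cdots\times[n_d]$, let $N\ge1$, and let $\hat p(x)=\frac1N\sum_{j=1}^N \mathbf 1[y^j=x]$ be the empirical density of $N$ i.i.d. samples $y^1,\dots,y^N$ from $p^*$. For $0\le l\le L$ and $k\in[2^l]$ let $\mathcal C_k^{(l)}=\{(k-1)2^{L-l}+1,\dots,k2^{L-l}\}$, let $\mathcal I_k^{(l)}$ and $\mathcal J_k^{(l)}$ be the sets of values of the variables inside and outside $\mathcal C_k^{(l)}$, and for a function $p$ on $[n_1]\times\cdots\times[n_d]$ let $p(\mathcal I_k^{(l)};\mathcal J_k^{(l)})$ be the unfolding matrix of $p$ with rows indexed by $\mathcal I_k^{(l)}$ and columns indexed by $\mathcal J_k^{(l)}$. *Algorithm.* Given are numbers $1\le r^{(l)}\le\tilde r^{(l)}$ and sketch matrices $S_k^{(l)}\in\mathbb R^{\mathcal I_k^{(l)}\times\tilde r^{(l)}}$, $T_k^{(l)}\in\mathbb R^{\mathcal J_k^{(l)}\times\tilde r^{(l)}}$ for $l\in[L]$, $k\in[2^l]$. For an input $p$ put $p_k^{(l)}=p(\mathcal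 I_k^{(l)};\mathcal J_k^{(l)})T_k^{(l)}$ and $A_k^{(l)}=S_k^{(l)T}p_k^{(l)}$ for $l\in[L]$, and $p_1^{(0)}=p$, $\tilde r^{(0)}=r^{(0)}=1$, $V_1^{(0)}=1$. For $l\in[L]$, $k\in[2^{l}]$ let $\mathcal P_{r^{(l)}}(A_k^{(l)})$ be a best approximation of $A_k^{(l)}$ in spectral norm among the matrices of rank at most $r^{(l)}$, and let $V_k^{(l)}\in\mathbb R^{\tilde r^{(l)}\times r^{(l)}}$ be the matrix of right singular vectors in a singular value decomposition of it with $r^{(l)}$ (possibly zero) singular values. For $l\in[L]$, $k\in[2^{l-1}]$ and $\gamma\in[\tilde r^{(l-1)}]$ put $B_k^{(l-1)}(:,:,\gamma)=S_{2k-1}^{(l)T}\,p_k^{(l-1)}(\mathcal I_{2k-1}^{(l)},\mathcal I_{2k}^{(l)},\gamma)\,S_{2k}^{(l)}$ and $$G_k^{(l-1)}(:,:,\gamma)=\bigl(\mathcal P_{r^{(l)}}(A_{2k-1}^{(l)})\bigr)^\dagger B_k^{(l-1)}(:,:,\gamma)\bigl(\mathcal P_{r^{(l)}}(A_{2k}^{(l)})^T\bigr)^\dagger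 ,$$ where $\dagger$ is the Moore–Penrose pseudo-inverse. The output $\mathcal A(p)$ is the function represented by the hierarchical tensor network with the cores $C_k^{(l-1)}(:,:,\gamma)=\sum_{\tilde\gamma}V_{2k-1}^{(l)T}G_k^{(l-1)}(:,:,\tilde\gamma)V_{2k}^{(l)}\,V_k^{(l-1)}(\tilde\gamma,\gamma)$ for $l\in[L]$, and $C_k^{(L)}=p_k^{(L)}V_k^{(L)}$: with $q_k^{(L)}=C_k^{(L)}$ and $q_k^{(l-1)}(:,:,\gamma)=q_{2k-1}^{(l)}C_k^{(l-1)}(:,:,\gamma)q_{2k}^{(l)T}$ one has $\mathcal A(p)=q_1^{(0)}$. Let $\tilde p=\mathcal A(\hat p)$. Write $*$ for the quantities obtained from the input $p^*$ and a hat for those obtained from $\hat p$, and let $\tilde p_k^{(L)}=\hat p_k^{(L)}$, $\tilde p_k^{(l-1)}(:,:,\gamma)=\tilde p_{2k-1}^{(l)}\hat G_k^{(l-1)}(:,:,\gamma)\tilde p_{2k}^{(l)T}$. *Assumptions.* For all $l\in[L]$, $k\in[2^l]$: $S_k^{(l)}$ and $T_k^{(l)}$ have orthonormal columns; $\operatorname{rank}p^*(\mathcal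 I_k^{(l)};\mathcal J_k^{(l)})\le r^{(l)}$; and the range conditions $\operatorname{Range}\bigl(p^*(\mathcal I_k^{(l)};\mathcal J_k^{(l)})T_k^{(l)}\bigr)=\operatorname{Range}\bigl(p^*(\mathcal I_k^{(l)};\mathcal J_k^{(l)})\bigr)$ and $\operatorname{Range}\bigl(p^*(\mathcal I_k^{(l)};\mathcal J_k^{(l)})^TS_k^{(l)}\bigr)=\operatorname{Range}\bigl(p^*(\mathcal I_k^{(l)};\mathcal J_k^{(l)})^T\bigr)$ hold. Let $c_{A^\dagger}$ and $c_p$ be numbers with $\|(A_k^{(l)*})^\dagger\|_2\le c_{A^\dagger}$, $\|p_k^{(l)*}\|_F\le c_p$ for $l\in[L]$, $k\in[2^l]$, and $\|p^*\|_F\le c_p$. *Theorem.* For every $0<\delta<1$, with probability at least $1-\delta$ over the samples, the following holds for all choices of the best approximations and their singular value decompositions in the algorithm: for all numbers $c_{\hat A^\dagger}$, $c_{\tilde p}$ with $\|(\mathcal P_{r^{(l)}}(\hat A_k^{(l)}))^\dagger\|_2\le c_{\hat A^\dagger}$ and $\|\tilde p_k^{(l)}\|_F\le c_{\tilde p}$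 for $l\in[L]$, $k\in[2^l]$, and with $c_{A^\dagger}^2c_pc_{\tilde p}+c_{A^\dagger}^2c_p^2>1$, $$\|\tilde p-p^*\|_F\le\tilde C\,\bigl(c_{A^\dagger}^2c_pc_{\tilde p}+c_{A^\dagger}^2c_p^2\bigr)^{\log_2 d}\,\frac{\log\bigl(2\tilde r_{\max}d\log_2 d/\delta\bigr)}{\sqrt N},$$ where $\tilde r_{\max}=\max_{l\in[L]}\tilde r^{(l)}$ and $$\tilde C=3\sqrt{\tilde r_{\max}}\left(1+\frac{c_{\tilde p}^2\bigl(c_{\hat A^\dagger}^2+6c_{A^\dagger}c_{\hat A^\dagger}^2c_p+6c_{A^\dagger}^2c_{\hat A^\dagger}c_p\bigr)}{c_{A^\dagger}^2c_pc_{\tilde p}+c_{A^\dagger}^2c_p^2-1}\right).$$ -/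

import Mathlib

open scoped Matrix

noncomputable section

namespace HierTN

/-! ### Norms and the Moore-Penrose pseudo-inverse -/

/-- Frobenius norm of a tensor with real entries indexed by a finite type. -/
def frob {α : Type*} [Fintype α] (f : α → ℝ) : ℝ := Real.sqrt (∑ a, f a ^ 2)

/-- Frobenius norm of a matrix. -/
def frobM {α β : Type*} [Fintype α] [Fintype β] (M : Matrix α β ℝ) : ℝ :=
  frob fun q : α × β => M q.1 q.2

open scoped Matrix.Norms.L2Operator in
/-- Spectral norm of a matrix (operator norm between Euclidean spaces). -/
def specNorm {α β : Type*} [Fintype α] [Fintype β] [DecidableEq β] (M : Matrix α β ℝ) : ℝ := ‖M‖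

/-- The four Penrose equations. -/
structure IsMoorePenrose {α β : Type*} [Fintype α] [Fintype β]
    (A : Matrix α β ℝ) (X : Matrix β α ℝ) : Prop where
  mul_mul_left : A * X * A = A
  mul_mul_right : X * A * X = X
  symm_left : (A * X)ᵀ = A * X
  symm_right : (X * A)ᵀ = X * A

theorem exists_isMoorePenrose {α β : Type*} [Fintype α] [Fintype β] [DecidableEq β]
    (A : Matrix α β ℝ) : ∃ X, IsMoorePenrose A X := by
  have hH : (Aᵀ * A).IsHermitian := by
    simpa using Matrix.isHermitian_conjTranspose_mul_self A
  obtain ⟨Q, D, hQ, hD⟩ : ∃ (Q : Matrix β β ℝ) (D : β → ℝ), Qᵀ * Q = 1 ∧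
      Aᵀ * A = Q * Matrix.diagonal D * Qᵀ := by
    refine ⟨hH.eigenvectorUnitary, hH.eigenvalues, ?_, ?_⟩
    · have := Unitary.coe_star_mul_self hH.eigenvectorUnitary
      simpa [Matrix.star_eq_conjTranspose] using this
    · have := hH.spectral_theorem
      simpa [Unitary.conjStarAlgAut_apply, Matrix.star_eq_conjTranspose, Function.comp_def]
        using this
  set E : Matrix β β ℝ := Matrix.diagonal fun i => (D i)⁻¹ with hE
  have hDE : Matrix.diagonal D * E * Matrix.diagonal D = Matrix.diagonal D := by
    rw [hE, Matrix.diagonal_mul_diagonal, Matrix.diagonal_mul_diagonal]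
    congr 1; funext i; exact mul_inv_mul_cancel (D i)
  have hED : E * Matrix.diagonal D * E = E := by
    rw [hE, Matrix.diagonal_mul_diagonal, Matrix.diagonal_mul_diagonal]
    congr 1; funext i; by_cases hi : D i = 0 <;> simp [hi]
  have hcomm : Matrix.diagonal D * E = E * Matrix.diagonal D := by
    rw [hE, Matrix.diagonal_mul_diagonal, Matrix.diagonal_mul_diagonal]
    congr 1; funext i; exact mul_comm _ _
  have hEt : Eᵀ = E := by rw [hE, Matrix.diagonal_transpose]
  have hQ' : ∀ M : Matrix β β ℝ, Qᵀ * (Q * M) = M := fun M => by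
    rw [← Matrix.mul_assoc, hQ, Matrix.one_mul]
  have hQ'' : ∀ M : Matrix β α ℝ, Qᵀ * (Q * M) = M := fun M => by
    rw [← Matrix.mul_assoc, hQ, Matrix.one_mul]
  set X : Matrix β α ℝ := Q * E * Qᵀ * Aᵀ with hX
  have hXA : X * A = Q * (E * Matrix.diagonal D) * Qᵀ := by
    calc X * A = Q * E * Qᵀ * (Aᵀ * A) := by rw [hX, Matrix.mul_assoc _ Aᵀ A]
      _ = Q * (E * Matrix.diagonal D) * Qᵀ := by
        rw [hD]; simp only [Matrix.mul_assoc, hQ']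
  have hXAs : (X * A)ᵀ = X * A := by
    rw [hXA]
    rw [Matrix.transpose_mul, Matrix.transpose_mul, Matrix.transpose_mul,
      Matrix.transpose_transpose, hEt, Matrix.diagonal_transpose, hcomm]
    simp only [Matrix.mul_assoc]
  have hAXA : Aᵀ * A * (X * A) = Aᵀ * A := by
    rw [hXA, hD]
    simp only [Matrix.mul_assoc, hQ']
    rw [← Matrix.mul_assoc E, ← Matrix.mul_assoc (Matrix.diagonal D),
      ← Matrix.mul_assoc (Matrix.diagonal D) E, hDE]
  refine ⟨X, ?_, ?_, ?_, hXAs⟩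
  · have h0 : (A * (X * A) - A)ᵀ * (A * (X * A) - A) = 0 := by
      have h1 : Aᵀ * (A * (X * A) - A) = 0 := by
        rw [Matrix.mul_sub, ← Matrix.mul_assoc, hAXA, sub_self]
      rw [Matrix.transpose_sub, Matrix.transpose_mul, Matrix.sub_mul, Matrix.mul_assoc, h1,
        Matrix.mul_zero, sub_self]
    have h2 : A * (X * A) - A = 0 := by
      have : (A * (X * A) - A)ᴴ * (A * (X * A) - A) = 0 := by simpa using h0
      exact Matrix.conjTranspose_mul_self_eq_zero.mp this
    rw [Matrix.mul_assoc]
    exact sub_eq_zero.mp h2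
  · rw [hXA, hX]
    calc Q * (E * Matrix.diagonal D) * Qᵀ * (Q * E * Qᵀ * Aᵀ)
        = Q * (E * Matrix.diagonal D * E) * Qᵀ * Aᵀ := by simp only [Matrix.mul_assoc, hQ'']
      _ = Q * E * Qᵀ * Aᵀ := by rw [hED]
  · rw [hX]
    simp only [Matrix.transpose_mul, Matrix.transpose_transpose, hEt, Matrix.mul_assoc]

/-- The Moore-Penrose pseudo-inverse. -/
def pinv {α β : Type*} [Fintype α] [Fintype β] [DecidableEq β] (A : Matrix α β ℝ) :
    Matrix β α ℝ :=
  Classical.choose (exists_isMoorePenrose A)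

theorem pinv_isMoorePenrose {α β : Type*} [Fintype α] [Fintype β] [DecidableEq β]
    (A : Matrix α β ℝ) : IsMoorePenrose A (pinv A) :=
  Classical.choose_spec (exists_isMoorePenrose A)

/-! ### Clusters and unfoldings

There are `d = 2 ^ L` variables, indexed from `0`. A node of the binary tree is given by its
height `h` (it lies at level `l = L - h`) and its number `k < 2 ^ (L - h)`, counted from `0`; its
cluster consists of the variables `k * 2 ^ h, ..., (k + 1) * 2 ^ h - 1`, that is, of the `i` with
`i / 2 ^ h = k`. The children of the node `(h + 1, k)` are `(h, 2 * k)` and `(h, 2 * k + 1)`,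
the leaves are the nodes `(0, k)`, and the root is `(L, 0)`. -/

/-- All values of the variables `(x_1, ..., x_d)`. -/
abbrev State {d : ℕ} (n : Fin d → ℕ) : Type := ∀ i, Fin (n i)

/-- All values of the variables in the cluster of the node `(h, k)`. -/
abbrev In {d : ℕ} (n : Fin d → ℕ) (h k : ℕ) : Type :=
  ∀ i : {i : Fin d // i.val / 2 ^ h = k}, Fin (n i)

/-- All values of the variables outside the cluster of the node `(h, k)`. -/
abbrev Out {d : ℕ} (n : Fin d → ℕ) (h k : ℕ) : Type :=
  ∀ i : {i : Fin d // ¬ i.val / 2 ^ h = k}, Fin (n i)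

/-- The unfolding matrix of `p` whose rows are indexed by the variables in a cluster and whose
columns are indexed by the other variables. -/
def unfolding {d : ℕ} {n : Fin d → ℕ} (p : State n → ℝ) (h k : ℕ) :
    Matrix (In n h k) (Out n h k) ℝ :=
  Matrix.of fun x y =>
    p ((Equiv.piEquivPiSubtypeProd (fun i : Fin d => i.val / 2 ^ h = k)
      (fun i => Fin (n i))).symm (x, y))

theorem div_parent {i h k : ℕ} (c : ℕ) (hc : c < 2) (hi : i / 2 ^ h = 2 * k + c) :
    i / 2 ^ (h + 1) = k := by
  rw [pow_succ, ← Nat.div_div_eq_div_mul, hi]; omega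

theorem div_child {i h k : ℕ} (hi : i / 2 ^ (h + 1) = k) (hn : ¬ i / 2 ^ h = 2 * k) :
    i / 2 ^ h = 2 * k + 1 := by
  rw [pow_succ, ← Nat.div_div_eq_div_mul] at hi; omega

/-- A cluster is the disjoint union of the clusters of its two children. -/
def split {d : ℕ} (n : Fin d → ℕ) (h k : ℕ) :
    In n (h + 1) k ≃ In n h (2 * k) × In n h (2 * k + 1) where
  toFun x := (fun i => x ⟨i.1, div_parent 0 (by norm_num) i.2⟩,
    fun i => x ⟨i.1, div_parent 1 (by norm_num) i.2⟩)
  invFun z := fun i =>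
    if hi : i.1.val / 2 ^ h = 2 * k then z.1 ⟨i.1, hi⟩ else z.2 ⟨i.1, div_child i.2 hi⟩
  left_inv x := by
    funext i
    by_cases hi : i.1.val / 2 ^ h = 2 * k <;> simp [hi]
  right_inv z := by
    refine Prod.ext (funext fun i => ?_) (funext fun i => ?_)
    · simp [i.2]
    · have : ¬ i.1.val / 2 ^ h = 2 * k := by rw [i.2]; omega
      simp [this]

/-- The point of the root cluster given by the values of all variables. -/
def rootPoint {d : ℕ} {n : Fin d → ℕ} (L : ℕ) (x : State n) : In n L 0 := fun i => x i

/-- Contraction of a hierarchical tensor network with leg dimensions `s h`: the function of the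
variables in the cluster of `(h, k)`, and of the upper leg of `(h, k)`, which is represented by the
part of the network at and below the node `(h, k)`. -/
def contract {d : ℕ} {n : Fin d → ℕ} {s : ℕ → ℕ}
    (leaf : ∀ k, Matrix (In n 0 k) (Fin (s 0)) ℝ)
    (core : ∀ h _k : ℕ, Fin (s (h + 1)) → Matrix (Fin (s h)) (Fin (s h)) ℝ) :
    ∀ h k : ℕ, Matrix (In n h k) (Fin (s h)) ℝ
  | 0, k => leaf k
  | h + 1, k => Matrix.of fun x c =>
      (contract leaf core h (2 * k) * core h k c * (contract leaf core h (2 * k + 1))ᵀ)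
        (split n h k x).1 (split n h k x).2

/-! ### The algorithm -/

/-- The input of the algorithm besides the function: numbers `rt h` of sketch functions, ranks
`r h` and sketch matrices `S h k`, `T h k`. At the root both numbers are `1` and the sketch `T` is
trivial, so that the sketched function there is the function itself. Only the heights `h ≤ L` and
the numbers `k < 2 ^ (L - h)` (for `S`: `h < L`) matter. -/
structure Sketch (L : ℕ) (n : Fin (2 ^ L) → ℕ) where
  rt : ℕ → ℕ
  r : ℕ → ℕ
  S : ∀ h k : ℕ, Matrix (In n h k) (Fin (rt h)) ℝ
  T : ∀ h k : ℕ, Matrix (Out n h k) (Fin (rt h)) ℝ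
  rt_root : rt L = 1
  r_root : r L = 1
  T_root : ∀ y c, T L 0 y c = 1

namespace Sketch

variable {L : ℕ} {n : Fin (2 ^ L) → ℕ} (sk : Sketch L n) (p : State n → ℝ)

/-- The sketched function at a node. -/
def sketched (h k : ℕ) : Matrix (In n h k) (Fin (sk.rt h)) ℝ := unfolding p h k * sk.T h k

/-- The reduced coefficient matrix `A` at a node. -/
def A (h k : ℕ) : Matrix (Fin (sk.rt h)) (Fin (sk.rt h)) ℝ := (sk.S h k)ᵀ * sk.sketched p h k

/-- A slice of the sketched function at `(h + 1, k)`, as a matrix indexed by the variables of the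
two children. -/
def slice (h k : ℕ) (c : Fin (sk.rt (h + 1))) : Matrix (In n h (2 * k)) (In n h (2 * k + 1)) ℝ :=
  Matrix.of fun x y => sk.sketched p (h + 1) k ((split n h k).symm (x, y)) c

/-- The reduced right-hand side `B` at the node `(h + 1, k)`. -/
def B (h k : ℕ) (c : Fin (sk.rt (h + 1))) : Matrix (Fin (sk.rt h)) (Fin (sk.rt h)) ℝ :=
  (sk.S h (2 * k))ᵀ * sk.slice p h k c * sk.S h (2 * k + 1)

/-- A choice, at every node other than the root, of a best approximation (in spectral norm) of the
matrix `A` of `p` among the matrices of rank at most `r h`, together with a singular value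
decomposition `U * diagonal σ * Vᵀ` of it. Such approximations need not be unique. -/
structure Trimming where
  U : ∀ h _k : ℕ, Matrix (Fin (sk.rt h)) (Fin (sk.r h)) ℝ
  σ : ∀ h _k : ℕ, Fin (sk.r h) → ℝ
  V : ∀ h _k : ℕ, Matrix (Fin (sk.rt h)) (Fin (sk.r h)) ℝ
  U_orth : ∀ h k, h < L → k < 2 ^ (L - h) → (U h k)ᵀ * U h k = 1
  V_orth : ∀ h k, h < L → k < 2 ^ (L - h) → (V h k)ᵀ * V h k = 1
  σ_nonneg : ∀ h k, h < L → k < 2 ^ (L - h) → ∀ a, 0 ≤ σ h k a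
  best : ∀ h k, h < L → k < 2 ^ (L - h) →
    ∀ M : Matrix (Fin (sk.rt h)) (Fin (sk.rt h)) ℝ, M.rank ≤ sk.r h →
      specNorm (sk.A p h k - U h k * Matrix.diagonal (σ h k) * (V h k)ᵀ)
        ≤ specNorm (sk.A p h k - M)
  V_root : ∀ a b, V L 0 a b = 1

namespace Trimming

variable {sk p} (t : sk.Trimming p)

/-- The trimmed matrix `A` at a node. -/
def P (h k : ℕ) : Matrix (Fin (sk.rt h)) (Fin (sk.rt h)) ℝ :=
  t.U h k * Matrix.diagonal (t.σ h k) * (t.V h k)ᵀ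

/-- The core `G` at the node `(h + 1, k)`. -/
def G (h k : ℕ) (c : Fin (sk.rt (h + 1))) : Matrix (Fin (sk.rt h)) (Fin (sk.rt h)) ℝ :=
  pinv (t.P h (2 * k)) * sk.B p h k c * pinv ((t.P h (2 * k + 1))ᵀ)

/-- The function at the node `(h, k)` that is recovered from the sketched functions at the leaves
and the cores `G`. -/
def recovered (h k : ℕ) : Matrix (In n h k) (Fin (sk.rt h)) ℝ :=
  contract (fun k => sk.sketched p 0 k) t.G h k

/-- The trimmed core `C` at the node `(h + 1, k)`. -/
def C (h k : ℕ) (c : Fin (sk.r (h + 1))) : Matrix (Fin (sk.r h)) (Fin (sk.r h)) ℝ :=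
  ∑ g : Fin (sk.rt (h + 1)),
    t.V (h + 1) k g c • ((t.V h (2 * k))ᵀ * t.G h k g * t.V h (2 * k + 1))

/-- The trimmed core `C` at the leaf `k`. -/
def CLeaf (k : ℕ) : Matrix (In n 0 k) (Fin (sk.r 0)) ℝ := sk.sketched p 0 k * t.V 0 k

/-- The output of the algorithm: the function represented by the cores `C`. -/
def output : State n → ℝ := fun x =>
  contract t.CLeaf t.C L 0 (rootPoint L x) ⟨0, by rw [sk.r_root]; exact one_pos⟩

end Trimming

end Sketch

/-- Range of a matrix: the span of its columns. -/
def colRange {α β : Type*} [Fintype β] (M : Matrix α β ℝ) : Submodule ℝ (α → ℝ) :=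
  LinearMap.range M.mulVecLin

/-- The empirical density of a sample. -/
def empirical {d N : ℕ} {n : Fin d → ℕ} (y : Fin N → State n) : State n → ℝ :=
  fun x => (1 / (N : ℝ)) * ∑ j, if y j = x then 1 else 0

/-- The growth factor of the error per level. -/
def growth (cA cp cpt : ℝ) : ℝ := cA ^ 2 * cp * cpt + cA ^ 2 * cp ^ 2

/-- The constant in front of the error bound. -/
def errConst (rmax : ℕ) (cA cAhat cp cpt : ℝ) : ℝ :=
  3 * Real.sqrt rmax *
    (1 + cpt ^ 2 * (cAhat ^ 2 + 6 * cA * cAhat ^ 2 * cp + 6 * cA ^ 2 * cAhat * cp) /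
      (growth cA cp cpt - 1))

end HierTN

end

open HierTN MeasureTheory ProbabilityTheory

namespace HierTN

/-! ### Pairs of orthogonal projections -/

section Projections

open scoped RealInnerProductSpace

variable {E : Type*} [NormedAddCommGroup E] [InnerProductSpace ℝ E] [CompleteSpace E]

/-! The proof combines a deterministic stability bound, `frob_output_sub_le`, with one concentration
event. Sketches with orthonormal columns are contractions, so a single bound ε on the Frobenius
distance between `empirical` and the true density controls the errors of the sketched functions and
of all `A` and `B`. No union bound over the tree is needed.

The bases `V` cancel between neighbouring cores, so by `output_eq` the output is the function
`recovered` at the root. For the true density, the range conditions make the same recursion exact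
(`slice_eq`). The error at a node is then a telescoping sum (`frobT_contract_sub_le`): the errors of
the two children enter with the factor `growth`, and the errors of `B` and of the two
pseudo-inverses add a term of order ε. Summing the geometric series over the levels gives the bound.

A pseudo-inverse need not depend continuously on its matrix, but here it only acts on the range of
the exact `A`. There `specNorm_mul_mul_sub_le` bounds the change, provided that the perturbation
cannot annihilate a vector of the exact row space. Comparing two orthogonal projections brings the
norm of the perturbed pseudo-inverse into this bound. If the perturbation is too large for that, ε
is so large that the claimed bound holds trivially (`le_growth_mul_sqrt_mul`); hence no lower bound
on the sample size is required.

Concentration is independent of the dimension: along the sums s of centred samples, the exponential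
of √(1 + ‖s‖²) grows by a bounded factor per step in expectation (`sum_exp_sqrt_one_add_norm_le`),
and Markov's inequality gives an exponential tail. -/

theorem norm_sq_eq_of_projection {Q : E →L[ℝ] E} (hQ : Q * Q = Q) (hQs : IsSelfAdjoint Q) (x : E) :
    ‖x‖ ^ 2 = ‖Q x‖ ^ 2 + ‖x - Q x‖ ^ 2 := by
  have h0 : ⟪Q x, x - Q x⟫ = 0 := by
    have h1 : ⟪Q x, x - Q x⟫ = ⟪x, Q (x - Q x)⟫ :=
      ContinuousLinearMap.isSelfAdjoint_iff_isSymmetric.mp hQs x (x - Q x)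
    have h2 : Q (Q x) = Q x := by
      rw [← mul_apply_eq_comp, hQ]
    rw [h1, map_sub, h2, sub_self, inner_zero_right]
  have h := norm_add_sq_real (Q x) (x - Q x)
  rw [h0, add_sub_cancel] at h
  linarith

theorem norm_apply_le_of_projection {Q : E →L[ℝ] E} (hQ : Q * Q = Q) (hQs : IsSelfAdjoint Q)
    (x : E) : ‖Q x‖ ≤ ‖x‖ := by
  have := norm_sq_eq_of_projection hQ hQs x
  exact abs_le_of_sq_le_sq' (by nlinarith [sq_nonneg ‖x - Q x‖]) (norm_nonneg _) |>.2

theorem norm_sub_apply_le_of_projection {Q : E →L[ℝ] E} (hQ : Q * Q = Q) (hQs : IsSelfAdjoint Q)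
    (x : E) : ‖x - Q x‖ ≤ ‖x‖ := by
  have := norm_sq_eq_of_projection hQ hQs x
  exact abs_le_of_sq_le_sq' (by nlinarith [sq_nonneg ‖Q x‖]) (norm_nonneg _) |>.2

/-- If every vector in the range of the orthogonal projection `Q` makes an angle less than `π / 2`
with the range of the orthogonal projection `R`, then the angle in that direction is at most the
one in the other direction. -/
theorem norm_one_sub_mul_projection_le {Q R : E →L[ℝ] E} (hQ : Q * Q = Q) (hQs : IsSelfAdjoint Q)
    (hR : R * R = R) (hRs : IsSelfAdjoint R) {θ : ℝ} (hθ : ‖(1 - Q) * R‖ ≤ θ)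
    (h1 : ‖(1 - R) * Q‖ < 1) : ‖(1 - R) * Q‖ ≤ θ := by
  have hθ0 : 0 ≤ θ := (norm_nonneg _).trans hθ
  have hlt : ‖Q * (1 - R) * Q‖ < 1 := by
    have hs : star ((1 - R) * Q) * ((1 - R) * Q) = Q * (1 - R) * Q := by
      rw [star_mul, hQs.star_eq, star_sub, star_one, hRs.star_eq]
      have : (1 - R) * (1 - R) = 1 - R := by
        rw [mul_sub, sub_mul, sub_mul, hR]; simp
      calc Q * (1 - R) * ((1 - R) * Q) = Q * ((1 - R) * (1 - R)) * Q := by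
            simp only [mul_assoc]
        _ = _ := by rw [this]
    have hn : ‖star ((1 - R) * Q) * ((1 - R) * Q)‖ = ‖(1 - R) * Q‖ * ‖(1 - R) * Q‖ :=
      ContinuousLinearMap.norm_adjoint_comp_self _
    rw [← hs, hn]
    nlinarith [norm_nonneg ((1 - R) * Q)]
  -- A Neumann series inverts `1 - Q(1 - R)Q`, which agrees with `QRQ` on the range of `Q`. Hence
  -- every `z` in that range is `Q x` for some `x` in the range of `R`.
  obtain ⟨W, hW⟩ := (Units.oneSub _ hlt).isUnit.exists_right_inv
  rw [Units.val_oneSub] at hW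
  have hQRQ : Q * R * Q * W = Q := by
    have : Q * (1 - Q * (1 - R) * Q) = Q * R * Q := by
      simp only [mul_sub, sub_mul, ← mul_assoc, hQ, mul_one]
      abel
    rw [← this, mul_assoc, hW, mul_one]
  refine ContinuousLinearMap.opNorm_le_bound _ hθ0 fun v => ?_
  set z := Q v with hz
  have hQz : Q z = z := by rw [hz, ← mul_apply_eq_comp, hQ]
  set x := R (Q (W z)) with hx
  have hRx : R x = x := by rw [hx, ← mul_apply_eq_comp, hR]
  have hQx : Q x = z := by
    conv_rhs => rw [← hQz, ← hQRQ]
    rfl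
  have hzv : ‖z‖ ≤ ‖v‖ := norm_apply_le_of_projection hQ hQs v
  have hxz : ‖x - z‖ ≤ θ * ‖x‖ := by
    have : x - z = ((1 - Q) * R) x := by
      simp [hRx, hQx]
    rw [this]
    exact (ContinuousLinearMap.le_opNorm _ _).trans (mul_le_mul_of_nonneg_right hθ (norm_nonneg _))
  have hpy : ‖x‖ ^ 2 = ‖z‖ ^ 2 + ‖x - z‖ ^ 2 := by
    simpa [hQx] using norm_sq_eq_of_projection hQ hQs x
  have hgoal : ((1 - R) * Q) v = z - R z := by
    simp [hz]
  rw [hgoal]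
  suffices ‖z - R z‖ ≤ θ * ‖z‖ from this.trans (mul_le_mul_of_nonneg_left hzv hθ0)
  by_cases hx0 : x = 0
  · have : z = 0 := by rw [← hQx, hx0, map_zero]
    simp [this]
  have hxpos : 0 < ‖x‖ := norm_pos_iff.mpr hx0
  -- `α • x` is the orthogonal projection of `z` onto the line through `x`. As this line lies in the
  -- range of `R`, the distance from `z` to `α • x` bounds the distance to the range.
  set α : ℝ := ‖z‖ ^ 2 / ‖x‖ ^ 2 with hα
  have hα2 : α * ‖x‖ ^ 2 = ‖z‖ ^ 2 := div_mul_cancel₀ _ (by positivity)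
  have hα0 : 0 ≤ α := by positivity
  have heq : z - R z = (z - α • x) - R (z - α • x) := by
    rw [map_sub, map_smul, hRx]; abel
  rw [heq]
  refine (norm_sub_apply_le_of_projection hR hRs _).trans ?_
  have hin : ⟪z, x⟫ = ‖z‖ ^ 2 := by
    have := norm_sub_sq_real x z
    rw [real_inner_comm] at this
    linarith
  refine abs_le_of_sq_le_sq' ?_ (by positivity) |>.2
  rw [norm_sub_sq_real, inner_smul_right, hin, norm_smul, Real.norm_of_nonneg hα0]
  have h3 : ‖x - z‖ ^ 2 ≤ θ ^ 2 * ‖x‖ ^ 2 := by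
    rw [← mul_pow]; exact pow_le_pow_left₀ (norm_nonneg _) hxz 2
  have h4 : ‖z‖ ^ 2 - 2 * (α * ‖z‖ ^ 2) + (α * ‖x‖) ^ 2 = α * ‖x - z‖ ^ 2 := by
    have : (α * ‖x‖) ^ 2 = α * ‖z‖ ^ 2 := by rw [← hα2]; ring
    have h5 : ‖x - z‖ ^ 2 = ‖x‖ ^ 2 - ‖z‖ ^ 2 := by linarith
    rw [this, h5, mul_sub, hα2]; ring
  rw [h4]
  calc α * ‖x - z‖ ^ 2 ≤ α * (θ ^ 2 * ‖x‖ ^ 2) := mul_le_mul_of_nonneg_left h3 hα0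
    _ = θ ^ 2 * (α * ‖x‖ ^ 2) := by ring
    _ = (θ * ‖z‖) ^ 2 := by rw [hα2]; ring

end Projections

/-! ### Frobenius and spectral norms -/

section Norms

variable {α β γ δ : Type*} [Fintype α] [Fintype β] [Fintype γ] [Fintype δ]

theorem frob_eq_norm (f : α → ℝ) : frob f = ‖WithLp.toLp 2 f‖ := by
  rw [EuclideanSpace.norm_eq, frob]
  simp

theorem frob_nonneg (f : α → ℝ) : 0 ≤ frob f := Real.sqrt_nonneg _

theorem frob_sq (f : α → ℝ) : frob f ^ 2 = ∑ a, f a ^ 2 :=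
  Real.sq_sqrt (Finset.sum_nonneg fun _ _ => sq_nonneg _)

theorem frob_add_le (f g : α → ℝ) : frob (fun a => f a + g a) ≤ frob f + frob g := by
  simp only [frob_eq_norm]
  exact norm_add_le (WithLp.toLp 2 f) (WithLp.toLp 2 g)

theorem frob_sub_comm (f g : α → ℝ) : frob (fun a => f a - g a) = frob (fun a => g a - f a) := by
  unfold frob; congr 1; exact Finset.sum_congr rfl fun a _ => by ring

theorem frob_le_add_frob_sub (f g : α → ℝ) : frob f ≤ frob g + frob (fun a => f a - g a) := by
  simpa using frob_add_le g (fun a => f a - g a)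

theorem frob_sub_le (f g : α → ℝ) : frob (fun a => f a - g a) ≤ frob f + frob g := by
  simp only [frob_eq_norm]
  exact norm_sub_le (WithLp.toLp 2 f) (WithLp.toLp 2 g)

theorem frob_comp_equiv (e : α ≃ β) (f : β → ℝ) : frob (fun a => f (e a)) = frob f := by
  unfold frob; rw [Equiv.sum_comp e (fun b => f b ^ 2)]

theorem frob_le_mul_of_sq_le {f : α → ℝ} {g : β → ℝ} {c : ℝ} (hc : 0 ≤ c)
    (h : ∑ a, f a ^ 2 ≤ c ^ 2 * ∑ b, g b ^ 2) : frob f ≤ c * frob g := by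
  refine abs_le_of_sq_le_sq' ?_ (mul_nonneg hc (frob_nonneg _)) |>.2
  rwa [mul_pow, frob_sq, frob_sq]

/-- Frobenius norm of a family of matrices. -/
noncomputable def frobT (F : γ → Matrix α β ℝ) : ℝ := frob fun q : γ × α × β => F q.1 q.2.1 q.2.2

theorem frobM_nonneg (M : Matrix α β ℝ) : 0 ≤ frobM M := frob_nonneg _

theorem frobM_sq (M : Matrix α β ℝ) : frobM M ^ 2 = ∑ a, ∑ b, M a b ^ 2 := by
  rw [frobM, frob_sq, Fintype.sum_prod_type]

theorem frobM_transpose (M : Matrix α β ℝ) : frobM Mᵀ = frobM M :=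
  frob_comp_equiv (Equiv.prodComm β α) fun q => M q.1 q.2

theorem frobM_sub_comm (M N : Matrix α β ℝ) : frobM (M - N) = frobM (N - M) :=
  frob_sub_comm (fun q : α × β => M q.1 q.2) (fun q => N q.1 q.2)

theorem frobM_le_add_frobM_sub (M N : Matrix α β ℝ) : frobM M ≤ frobM N + frobM (M - N) :=
  frob_le_add_frob_sub (fun q : α × β => M q.1 q.2) (fun q => N q.1 q.2)

theorem frobT_nonneg (F : γ → Matrix α β ℝ) : 0 ≤ frobT F := frob_nonneg _

theorem frobT_sq (F : γ → Matrix α β ℝ) : frobT F ^ 2 = ∑ c, frobM (F c) ^ 2 := by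
  simp only [frobM_sq]
  rw [frobT, frob_sq, Fintype.sum_prod_type]
  simp only [Fintype.sum_prod_type]

theorem frobT_add_le (F G : γ → Matrix α β ℝ) : frobT (fun c => F c + G c) ≤ frobT F + frobT G :=
  frob_add_le (fun q : γ × α × β => F q.1 q.2.1 q.2.2) (fun q => G q.1 q.2.1 q.2.2)

theorem frobT_le_add_frobT_sub (F G : γ → Matrix α β ℝ) :
    frobT F ≤ frobT G + frobT (fun c => F c - G c) :=
  frob_le_add_frob_sub (fun q : γ × α × β => F q.1 q.2.1 q.2.2) (fun q => G q.1 q.2.1 q.2.2)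

theorem frobT_sub_le (F G : γ → Matrix α β ℝ) :
    frobT (fun c => F c - G c) ≤ frobT F + frobT G :=
  frob_sub_le (fun q : γ × α × β => F q.1 q.2.1 q.2.2) (fun q => G q.1 q.2.1 q.2.2)

theorem frobT_le_mul {α' β' : Type*} [Fintype α'] [Fintype β'] {F : γ → Matrix α β ℝ}
    {G : γ → Matrix α' β' ℝ} {c : ℝ} (hc : 0 ≤ c) (h : ∀ i, frobM (F i) ≤ c * frobM (G i)) :
    frobT F ≤ c * frobT G := by
  refine abs_le_of_sq_le_sq' ?_ (mul_nonneg hc (frobT_nonneg _)) |>.2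
  rw [mul_pow, frobT_sq, frobT_sq, Finset.mul_sum]
  refine Finset.sum_le_sum fun i _ => ?_
  rw [← mul_pow]
  exact pow_le_pow_left₀ (frobM_nonneg _) (h i) 2

open scoped Matrix.Norms.L2Operator

theorem specNorm_nonneg [DecidableEq β] (M : Matrix α β ℝ) : 0 ≤ specNorm M := norm_nonneg M

theorem specNorm_zero [DecidableEq β] : specNorm (0 : Matrix α β ℝ) = 0 := norm_zero

theorem specNorm_eq_zero [DecidableEq β] {M : Matrix α β ℝ} : specNorm M = 0 ↔ M = 0 :=
  norm_eq_zero

theorem specNorm_sub_le [DecidableEq β] (M N : Matrix α β ℝ) :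
    specNorm (M - N) ≤ specNorm M + specNorm N := norm_sub_le M N

theorem specNorm_sub_comm [DecidableEq β] (M N : Matrix α β ℝ) :
    specNorm (M - N) = specNorm (N - M) := norm_sub_rev M N

theorem specNorm_mul_le [DecidableEq β] [DecidableEq γ] (M : Matrix α β ℝ) (N : Matrix β γ ℝ) :
    specNorm (M * N) ≤ specNorm M * specNorm N := Matrix.l2_opNorm_mul M N

theorem specNorm_transpose [DecidableEq α] [DecidableEq β] (M : Matrix α β ℝ) :
    specNorm Mᵀ = specNorm M := by
  rw [← Matrix.conjTranspose_eq_transpose_of_trivial]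
  exact Matrix.l2_opNorm_conjTranspose M

theorem frob_mulVec_le [DecidableEq β] (M : Matrix α β ℝ) (v : β → ℝ) :
    frob (M.mulVec v) ≤ specNorm M * frob v := by
  rw [frob_eq_norm, frob_eq_norm]
  exact Matrix.l2_opNorm_mulVec M (WithLp.toLp 2 v)

theorem specNorm_le_of_mulVec [DecidableEq β] {M : Matrix α β ℝ} {c : ℝ} (hc : 0 ≤ c)
    (h : ∀ v : β → ℝ, frob (M.mulVec v) ≤ c * frob v) : specNorm M ≤ c := by
  refine ContinuousLinearMap.opNorm_le_bound _ hc fun x => ?_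
  have := h (WithLp.ofLp x)
  rw [frob_eq_norm, frob_eq_norm] at this
  exact this

theorem specNorm_le_frobM [DecidableEq β] (M : Matrix α β ℝ) : specNorm M ≤ frobM M := by
  refine specNorm_le_of_mulVec (frobM_nonneg _) fun v => ?_
  refine frob_le_mul_of_sq_le (frobM_nonneg _) ?_
  rw [frobM_sq, Finset.sum_mul]
  refine Finset.sum_le_sum fun a _ => ?_
  exact Finset.sum_mul_sq_le_sq_mul_sq Finset.univ (M a) v

theorem frobM_mul_le_left [DecidableEq β] (M : Matrix α β ℝ) (N : Matrix β γ ℝ) :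
    frobM (M * N) ≤ specNorm M * frobM N := by
  refine abs_le_of_sq_le_sq' ?_ (mul_nonneg (specNorm_nonneg _) (frobM_nonneg _)) |>.2
  rw [mul_pow, frobM_sq, frobM_sq, Finset.sum_comm, Finset.sum_comm (s := Finset.univ (α := β)),
    Finset.mul_sum]
  refine Finset.sum_le_sum fun c _ => ?_
  have h := pow_le_pow_left₀ (frob_nonneg _) (frob_mulVec_le M fun b => N b c) 2
  rw [mul_pow, frob_sq, frob_sq] at h
  exact h

theorem frobM_mul_le_right [DecidableEq β] [DecidableEq γ] (M : Matrix α β ℝ) (N : Matrix β γ ℝ) :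
    frobM (M * N) ≤ frobM M * specNorm N := by
  rw [← frobM_transpose, Matrix.transpose_mul]
  refine (frobM_mul_le_left _ _).trans_eq ?_
  rw [specNorm_transpose, frobM_transpose, mul_comm]

theorem specNorm_le_one_of_orthonormal [DecidableEq β] {S : Matrix α β ℝ} (hS : Sᵀ * S = 1) :
    specNorm S ≤ 1 := by
  refine specNorm_le_of_mulVec zero_le_one fun v => le_of_eq ?_
  rw [one_mul]
  unfold frob
  congr 1
  have h1 : ∀ {ι : Type _} [Fintype ι] (w : ι → ℝ), ∑ a, w a ^ 2 = w ⬝ᵥ w := fun w => by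
    simp [dotProduct, sq]
  have h2 : ∑ a, v a ^ 2 = v ⬝ᵥ v := by simp [dotProduct, sq]
  rw [h1, h2, Matrix.dotProduct_mulVec, ← Matrix.mulVec_transpose, Matrix.mulVec_mulVec, hS,
    Matrix.one_mulVec]

/-- Two-sided multiplication of a family of matrices. -/
theorem frobT_mul_mul_le [DecidableEq α] [DecidableEq β] [DecidableEq δ] {α' : Type*} [Fintype α']
    [DecidableEq α'] (X : Matrix α' α ℝ) (F : γ → Matrix α β ℝ) (Y : Matrix β δ ℝ) {x y : ℝ}
    (hx : specNorm X ≤ x) (hy : specNorm Y ≤ y) :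
    frobT (fun c => X * F c * Y) ≤ x * frobT F * y := by
  have hx0 : 0 ≤ x := (specNorm_nonneg _).trans hx
  have hy0 : 0 ≤ y := (specNorm_nonneg _).trans hy
  refine (frobT_le_mul (G := F) (mul_nonneg hx0 hy0) fun c => ?_).trans_eq (by ring)
  calc frobM (X * F c * Y) ≤ frobM (X * F c) * specNorm Y := frobM_mul_le_right _ _
    _ ≤ specNorm X * frobM (F c) * specNorm Y :=
      mul_le_mul_of_nonneg_right (frobM_mul_le_left _ _) (specNorm_nonneg _)
    _ ≤ x * frobM (F c) * y := by
      have := frobM_nonneg (F c)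
      have := specNorm_nonneg Y
      gcongr
    _ = x * y * frobM (F c) := by ring

end Norms

/-! ### The Moore-Penrose pseudo-inverse -/

section MoorePenrose

variable {α β : Type*} [Fintype α] [Fintype β]

namespace IsMoorePenrose

variable {A : Matrix α β ℝ} {X : Matrix β α ℝ}

theorem transpose (h : IsMoorePenrose A X) : IsMoorePenrose Aᵀ Xᵀ where
  mul_mul_left := by
    rw [← Matrix.transpose_mul, ← Matrix.transpose_mul, ← Matrix.mul_assoc, h.mul_mul_left]
  mul_mul_right := by
    rw [← Matrix.transpose_mul, ← Matrix.transpose_mul, ← Matrix.mul_assoc, h.mul_mul_right]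
  symm_left := by rw [← Matrix.transpose_mul, h.symm_right, h.symm_right]
  symm_right := by rw [← Matrix.transpose_mul, h.symm_left, h.symm_left]

/-- Since `pinv` is obtained by choice, identities such as `pinv_transpose` rest on uniqueness. -/
theorem unique {Y : Matrix β α ℝ} (hX : IsMoorePenrose A X) (hY : IsMoorePenrose A Y) : X = Y := by
  have h1 : A * X = A * Y := by
    calc A * X = (A * Y) * (A * X) := by
          rw [← Matrix.mul_assoc, hY.mul_mul_left]
      _ = ((A * X) * (A * Y))ᵀ := by rw [Matrix.transpose_mul, hX.symm_left, hY.symm_left]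
      _ = (A * Y)ᵀ := by rw [← Matrix.mul_assoc, hX.mul_mul_left]
      _ = A * Y := hY.symm_left
  have h2 : X * A = Y * A := by
    calc X * A = (X * A) * (Y * A) := by
          rw [Matrix.mul_assoc, ← Matrix.mul_assoc A, hY.mul_mul_left]
      _ = ((Y * A) * (X * A))ᵀ := by rw [Matrix.transpose_mul, hX.symm_right, hY.symm_right]
      _ = (Y * A)ᵀ := by rw [Matrix.mul_assoc, ← Matrix.mul_assoc A, hX.mul_mul_left]
      _ = Y * A := hY.symm_right
  calc X = X * A * X := hX.mul_mul_right.symm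
    _ = Y * A * Y := by rw [h2, Matrix.mul_assoc, h1, Matrix.mul_assoc]
    _ = Y := hY.mul_mul_right

end IsMoorePenrose

theorem pinv_transpose [DecidableEq α] [DecidableEq β] (A : Matrix α β ℝ) :
    pinv Aᵀ = (pinv A)ᵀ :=
  (pinv_isMoorePenrose Aᵀ).unique (pinv_isMoorePenrose A).transpose

open scoped Matrix.Norms.L2Operator

variable [DecidableEq α]

theorem specNorm_one_sub_mul_projection_le {Q R : Matrix α α ℝ} (hQ : Q * Q = Q) (hQs : Qᵀ = Q)
    (hR : R * R = R) (hRs : Rᵀ = R) {θ : ℝ} (hθ : specNorm ((1 - Q) * R) ≤ θ)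
    (h1 : specNorm ((1 - R) * Q) < 1) : specNorm ((1 - R) * Q) ≤ θ := by
  let T := Matrix.toEuclideanCLM (n := α) (𝕜 := ℝ)
  have hadj : ∀ M : Matrix α α ℝ, Mᵀ = M → IsSelfAdjoint (T M) := fun M hM => by
    have : star M = M := by simpa [Matrix.star_eq_conjTranspose] using hM
    rw [IsSelfAdjoint, ← map_star, this]
  have hn : ∀ M N : Matrix α α ℝ, specNorm ((1 - M) * N) = ‖(1 - T M) * T N‖ := fun M N => by
    rw [← map_one T, ← map_sub, ← map_mul]; rfl
  rw [hn] at hθ h1 ⊢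
  exact norm_one_sub_mul_projection_le (by rw [← map_mul, hQ]) (hadj _ hQs)
    (by rw [← map_mul, hR]) (hadj _ hRs) hθ h1

theorem specNorm_projection_le_one {Q : Matrix α α ℝ} (hQ : Q * Q = Q) (hQs : Qᵀ = Q) :
    specNorm Q ≤ 1 := by
  have h : ‖Qᴴ * Q‖ = ‖Q‖ * ‖Q‖ := Matrix.l2_opNorm_conjTranspose_mul_self Q
  have h2 : Qᴴ * Q = Q := by
    rw [Matrix.conjTranspose_eq_transpose_of_trivial, hQs, hQ]
  rw [h2] at h
  change ‖Q‖ ≤ 1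
  nlinarith [norm_nonneg Q, sq_nonneg (‖Q‖ - 1)]

/-- The part of the row space of `A` outside of the row space of a perturbation `P` of `A`. -/
theorem specNorm_one_sub_mul_le {A P X Y : Matrix α α ℝ} (hX : IsMoorePenrose A X)
    (hY : IsMoorePenrose P Y) :
    specNorm ((1 - Y * P) * (X * A)) ≤ specNorm (P - A) * specNorm X := by
  have h1 : (1 - Y * P) * Pᵀ = 0 := by
    have : Y * P * Pᵀ = Pᵀ := by
      rw [← hY.symm_right, ← Matrix.transpose_mul, ← Matrix.mul_assoc, hY.mul_mul_left]
    rw [Matrix.sub_mul, this, Matrix.one_mul, sub_self]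
  -- By symmetry `X * A = Aᵀ * Xᵀ`, and `h1` allows `Pᵀ` to be subtracted from `Aᵀ` for free.
  have h2 : (1 - Y * P) * (X * A) = (1 - Y * P) * ((A - P)ᵀ * Xᵀ) := by
    rw [← hX.symm_right, Matrix.transpose_mul, ← Matrix.mul_assoc, ← Matrix.mul_assoc,
      Matrix.transpose_sub, Matrix.mul_sub, h1, sub_zero]
  rw [h2]
  have hp : specNorm (1 - Y * P) ≤ 1 := by
    have hYP : Y * P * (Y * P) = Y * P := by rw [← Matrix.mul_assoc, hY.mul_mul_right]
    refine specNorm_projection_le_one ?_ ?_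
    · rw [Matrix.mul_sub, Matrix.sub_mul, Matrix.sub_mul, hYP]; simp
    · rw [Matrix.transpose_sub, hY.symm_right, Matrix.transpose_one]
  calc _ ≤ specNorm (1 - Y * P) * specNorm ((A - P)ᵀ * Xᵀ) := specNorm_mul_le _ _
    _ ≤ 1 * (specNorm (A - P)ᵀ * specNorm Xᵀ) :=
      mul_le_mul hp (specNorm_mul_le _ _) (specNorm_nonneg _) zero_le_one
    _ = _ := by rw [one_mul, specNorm_transpose, specNorm_transpose, specNorm_sub_comm]

/-- Perturbation of the pseudo-inverse on the column space of `A`. -/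
theorem specNorm_mul_mul_sub_le {A P X Y : Matrix α α ℝ} (hX : IsMoorePenrose A X)
    (hY : IsMoorePenrose P Y) {a b η : ℝ} (ha : specNorm X ≤ a) (hb : specNorm Y ≤ b)
    (hη : specNorm (P - A) ≤ η) (hlt : a * η < 1) :
    specNorm (Y * A * X - X) ≤ 2 * a * b * η := by
  have ha0 : 0 ≤ a := (specNorm_nonneg _).trans ha
  have hb0 : 0 ≤ b := (specNorm_nonneg _).trans hb
  have hη0 : 0 ≤ η := (specNorm_nonneg _).trans hη
  have hXA : X * A * (X * A) = X * A := by rw [← Matrix.mul_assoc, hX.mul_mul_right]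
  have hYP : Y * P * (Y * P) = Y * P := by rw [← Matrix.mul_assoc, hY.mul_mul_right]
  have h1 : specNorm ((1 - Y * P) * (X * A)) < 1 := by
    refine (specNorm_one_sub_mul_le hX hY).trans_lt (lt_of_le_of_lt ?_ hlt)
    rw [mul_comm a]
    exact mul_le_mul hη ha (specNorm_nonneg _) hη0
  have h2 : specNorm ((1 - X * A) * (Y * P)) ≤ η * b := by
    refine (specNorm_one_sub_mul_le hY hX).trans ?_
    rw [specNorm_sub_comm]
    exact mul_le_mul hη hb (specNorm_nonneg _) hη0
  have h3 := specNorm_one_sub_mul_projection_le hXA hX.symm_right hYP hY.symm_right h2 h1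
  have h4 : Y * A * X - X = -(Y * (P - A) * X) - (1 - Y * P) * (X * A) * X := by
    have : (1 - Y * P) * (X * A) * X = X - Y * P * X := by
      rw [Matrix.mul_assoc, hX.mul_mul_right, Matrix.sub_mul, Matrix.one_mul]
    rw [this, Matrix.mul_sub, Matrix.sub_mul]
    abel
  rw [h4]
  have h5 : specNorm (-(Y * (P - A) * X)) ≤ b * η * a := by
    have : specNorm (-(Y * (P - A) * X)) = specNorm (Y * (P - A) * X) := norm_neg _
    rw [this]
    calc _ ≤ specNorm (Y * (P - A)) * specNorm X := specNorm_mul_le _ _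
      _ ≤ specNorm Y * specNorm (P - A) * specNorm X :=
        mul_le_mul_of_nonneg_right (specNorm_mul_le _ _) (specNorm_nonneg _)
      _ ≤ b * η * a := by
        have := specNorm_nonneg X
        have := specNorm_nonneg (P - A)
        gcongr
  have h6 : specNorm ((1 - Y * P) * (X * A) * X) ≤ η * b * a :=
    (specNorm_mul_le _ _).trans (mul_le_mul h3 ha (specNorm_nonneg _) (by positivity))
  calc _ ≤ _ := specNorm_sub_le _ _
    _ ≤ b * η * a + η * b * a := add_le_add h5 h6
    _ = _ := by ring

end MoorePenrose

/-! ### Unfoldings, slices and sketches -/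

theorem frobM_unfolding {d : ℕ} {n : Fin d → ℕ} (p : State n → ℝ) (h k : ℕ) :
    frobM (unfolding p h k) = frob p :=
  frob_comp_equiv (Equiv.piEquivPiSubtypeProd (fun i : Fin d => i.val / 2 ^ h = k)
      (fun i => Fin (n i))).symm p

/-! ### Recovery of a matrix from sketches of its row and column spaces -/

section ColumnSpace

variable {α β γ : Type*} [Fintype α] [Fintype β] [Fintype γ]

omit [Fintype α] [Fintype β] in
theorem exists_eq_mul_of_forall_mem {M : Matrix α β ℝ} {N : Matrix α γ ℝ}
    (h : ∀ b, (fun a => M a b) ∈ colRange N) : ∃ X : Matrix γ β ℝ, M = N * X := by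
  choose w hw using h
  exact ⟨Matrix.of fun c b => w b c, by ext a b; exact (congrFun (hw b) a).symm⟩

omit [Fintype α] in
theorem col_mem_colRange (M : Matrix α β ℝ) (b : β) : (fun a => M a b) ∈ colRange M := by
  classical
  exact ⟨Pi.single b 1, by ext a; simp⟩

omit [Fintype α] in
theorem exists_eq_mul_of_colRange_le {M : Matrix α β ℝ} {N : Matrix α γ ℝ}
    (h : colRange M ≤ colRange N) : ∃ X : Matrix γ β ℝ, M = N * X :=
  exists_eq_mul_of_forall_mem fun b => h (col_mem_colRange M b)

/-- A matrix is recovered from sketches that capture its column space and its row space. -/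
theorem mul_pinv_mul_eq_self {δ : Type*} [Fintype δ] {M : Matrix α β ℝ}
    {T : Matrix β γ ℝ} {S : Matrix α δ ℝ} (hT : colRange (M * T) = colRange M)
    (hS : colRange (Mᵀ * S) = colRange Mᵀ) {X : Matrix γ δ ℝ}
    (hX : IsMoorePenrose (Sᵀ * (M * T)) X) : M * T * X * (Sᵀ * M) = M := by
  obtain ⟨W, hW⟩ := exists_eq_mul_of_colRange_le hT.ge
  obtain ⟨Z, hZ⟩ := exists_eq_mul_of_colRange_le hS.ge
  have hZ' : M = Zᵀ * (Sᵀ * M) := by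
    conv_lhs => rw [← Matrix.transpose_transpose M, hZ]
    simp only [Matrix.transpose_mul, Matrix.transpose_transpose, Matrix.mul_assoc]
  have h1 : M * T = Zᵀ * (Sᵀ * (M * T)) := by
    conv_lhs => rw [hZ']
    simp only [Matrix.mul_assoc]
  have h2 : Sᵀ * M = Sᵀ * (M * T) * W := by
    conv_lhs => rw [hW]
    simp only [Matrix.mul_assoc]
  calc M * T * X * (Sᵀ * M) = Zᵀ * (Sᵀ * (M * T)) * X * (Sᵀ * (M * T) * W) := by rw [← h1, ← h2]
    _ = Zᵀ * (Sᵀ * (M * T) * X * (Sᵀ * (M * T))) * W := by simp only [Matrix.mul_assoc]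
    _ = M := by rw [hX.mul_mul_left, Matrix.mul_assoc, ← h2, ← hZ']

end ColumnSpace

/-! ### Slices at a parent lie in the column spaces of its children -/

section Slices

variable {d : ℕ} {n : Fin d → ℕ}

/-- With the sibling's variables fixed at `y`, the sketch sums over the variables outside the
parent. Each summand is a multiple of the column of the child's unfolding whose index is glued from
`y` and the outer variables. -/
theorem of_mul_split_mem_colRange_left (p : State n → ℝ) (h k : ℕ) {γ : Type*}
    (T : Matrix (Out n (h + 1) k) γ ℝ) (c : γ) (y : In n h (2 * k + 1)) :
    (fun x => (unfolding p (h + 1) k * T) ((split n h k).symm (x, y)) c)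
      ∈ colRange (unfolding p h (2 * k)) := by
  have heq : (fun x => (unfolding p (h + 1) k * T) ((split n h k).symm (x, y)) c)
      = ∑ o : Out n (h + 1) k, T o c • fun x => unfolding p h (2 * k) x
        (fun i => if hi : i.1.val / 2 ^ (h + 1) = k then y ⟨i.1, div_child hi i.2⟩
          else o ⟨i.1, hi⟩) := by
    ext x
    rw [Matrix.mul_apply, Finset.sum_apply]
    refine Finset.sum_congr rfl fun o _ => ?_
    rw [Pi.smul_apply, smul_eq_mul, mul_comm]
    congr 1
    refine congrArg p (funext fun i => ?_)
    by_cases h1 : i.val / 2 ^ (h + 1) = k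
    · by_cases h2 : i.val / 2 ^ h = 2 * k <;>
        simp [Equiv.piEquivPiSubtypeProd, split, h1, h2]
    · have h2 : ¬ i.val / 2 ^ h = 2 * k := fun h2 => h1 (div_parent 0 (by norm_num) h2)
      simp [Equiv.piEquivPiSubtypeProd, h1, h2]
  rw [heq]
  exact Submodule.sum_mem _ fun o _ => Submodule.smul_mem _ _ (col_mem_colRange _ _)

theorem of_mul_split_mem_colRange_right (p : State n → ℝ) (h k : ℕ) {γ : Type*}
    (T : Matrix (Out n (h + 1) k) γ ℝ) (c : γ) (x : In n h (2 * k)) :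
    (fun y => (unfolding p (h + 1) k * T) ((split n h k).symm (x, y)) c)
      ∈ colRange (unfolding p h (2 * k + 1)) := by
  have hleft : ∀ {i : ℕ}, i / 2 ^ (h + 1) = k → ¬ i / 2 ^ h = 2 * k + 1 → i / 2 ^ h = 2 * k :=
    fun h1 h2 => by_contra fun h3 => h2 (div_child h1 h3)
  have heq : (fun y => (unfolding p (h + 1) k * T) ((split n h k).symm (x, y)) c)
      = ∑ o : Out n (h + 1) k, T o c • fun y => unfolding p h (2 * k + 1) y
        (fun i => if hi : i.1.val / 2 ^ (h + 1) = k then x ⟨i.1, hleft hi i.2⟩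
          else o ⟨i.1, hi⟩) := by
    ext y
    rw [Matrix.mul_apply, Finset.sum_apply]
    refine Finset.sum_congr rfl fun o _ => ?_
    rw [Pi.smul_apply, smul_eq_mul, mul_comm]
    congr 1
    refine congrArg p (funext fun i => ?_)
    by_cases h1 : i.val / 2 ^ (h + 1) = k
    · by_cases h2 : i.val / 2 ^ h = 2 * k
      · have h3 : ¬ i.val / 2 ^ h = 2 * k + 1 := by omega
        simp [Equiv.piEquivPiSubtypeProd, split, h1, h2]
      · have h3 : i.val / 2 ^ h = 2 * k + 1 := div_child h1 h2
        simp [Equiv.piEquivPiSubtypeProd, split, h1, h3]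
    · have h2 : ¬ i.val / 2 ^ h = 2 * k + 1 := fun h2 => h1 (div_parent 1 (by norm_num) h2)
      simp [Equiv.piEquivPiSubtypeProd, h1, h2]
  rw [heq]
  exact Submodule.sum_mem _ fun o _ => Submodule.smul_mem _ _ (col_mem_colRange _ _)

end Slices

/-! ### Sketched quantities: linearity, contraction and exact recovery -/

namespace Sketch

variable {L : ℕ} {n : Fin (2 ^ L) → ℕ} (sk : Sketch L n)

theorem sketched_sub (p q : State n → ℝ) (h k : ℕ) :
    sk.sketched p h k - sk.sketched q h k = sk.sketched (fun x => p x - q x) h k := by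
  rw [sketched, sketched, ← Matrix.sub_mul]; rfl

theorem frobM_sketched_le {h k : ℕ} (hT : (sk.T h k)ᵀ * sk.T h k = 1) (p : State n → ℝ) :
    frobM (sk.sketched p h k) ≤ frob p := by
  refine (frobM_mul_le_right _ _).trans ?_
  rw [frobM_unfolding]
  exact mul_le_of_le_one_right (frob_nonneg _) (specNorm_le_one_of_orthonormal hT)

theorem frobT_slice (p : State n → ℝ) (h k : ℕ) :
    frobT (sk.slice p h k) = frobM (sk.sketched p (h + 1) k) :=
  frob_comp_equiv ((Equiv.prodComm _ _).trans (Equiv.prodCongr (split n h k).symm (Equiv.refl _)))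
    fun q => sk.sketched p (h + 1) k q.1 q.2

theorem slice_sub (p q : State n → ℝ) (h k : ℕ) (c : Fin (sk.rt (h + 1))) :
    sk.slice p h k c - sk.slice q h k c = sk.slice (fun x => p x - q x) h k c := by
  ext x y
  exact congrFun (congrFun (sk.sketched_sub p q (h + 1) k) _) c

theorem B_sub (p q : State n → ℝ) (h k : ℕ) (c : Fin (sk.rt (h + 1))) :
    sk.B p h k c - sk.B q h k c = sk.B (fun x => p x - q x) h k c := by
  rw [B, B, B, ← slice_sub, Matrix.mul_sub, Matrix.sub_mul]

theorem frobT_B_le {h k : ℕ} (hl : (sk.S h (2 * k))ᵀ * sk.S h (2 * k) = 1)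
    (hr : (sk.S h (2 * k + 1))ᵀ * sk.S h (2 * k + 1) = 1) (p : State n → ℝ) :
    frobT (sk.B p h k) ≤ frobM (sk.sketched p (h + 1) k) := by
  have := frobT_mul_mul_le (sk.S h (2 * k))ᵀ (sk.slice p h k) (sk.S h (2 * k + 1)) (x := 1) (y := 1)
    (by rw [specNorm_transpose]; exact specNorm_le_one_of_orthonormal hl)
    (specNorm_le_one_of_orthonormal hr)
  rwa [one_mul, mul_one, frobT_slice] at this

/-- The conditions under which the sketches at a node capture the unfolding of `p`. -/
structure Captures (p : State n → ℝ) (h k : ℕ) : Prop where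
  colRange_T : colRange (unfolding p h k * sk.T h k) = colRange (unfolding p h k)
  colRange_S : colRange ((unfolding p h k)ᵀ * sk.S h k) = colRange ((unfolding p h k)ᵀ)

namespace Captures

variable {sk} {p : State n → ℝ} {h k : ℕ}

theorem sketched_mul_pinv_mul (hc : sk.Captures p h k) :
    sk.sketched p h k * pinv (sk.A p h k) * ((sk.S h k)ᵀ * unfolding p h k) = unfolding p h k :=
  mul_pinv_mul_eq_self hc.colRange_T hc.colRange_S (pinv_isMoorePenrose (sk.A p h k))

theorem A_mul_pinv_mul (hc : sk.Captures p h k) :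
    sk.A p h k * pinv (sk.A p h k) * ((sk.S h k)ᵀ * unfolding p h k)
      = (sk.S h k)ᵀ * unfolding p h k := by
  conv_rhs => rw [← hc.sketched_mul_pinv_mul]
  simp only [A, Matrix.mul_assoc]

/-- If `A` vanished, the reconstruction formula would make the whole unfolding vanish. Nonvanishing
yields positive ranks and `1 ≤ cA * cp` later on. -/
theorem A_ne_zero (hc : sk.Captures p h k) (hp : p ≠ 0) : sk.A p h k ≠ 0 := by
  intro h0
  have h1 : (sk.S h k)ᵀ * unfolding p h k = 0 := by
    rw [← hc.A_mul_pinv_mul, h0, Matrix.zero_mul, Matrix.zero_mul]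
  have h2 : unfolding p h k = 0 := by
    rw [← hc.sketched_mul_pinv_mul, h1, Matrix.mul_zero]
  have h3 : frob p = 0 := by
    rw [← frobM_unfolding p h k, h2]
    simp [frobM, frob]
  refine hp ?_
  rw [frob_eq_norm, norm_eq_zero] at h3
  exact congrArg WithLp.ofLp h3

variable (hl : sk.Captures p h (2 * k)) (hr : sk.Captures p h (2 * k + 1))
include hl

/-- The columns of `B` lie in the range of `Sᵀ` times the child's unfolding, which the projection `A
* pinv A` fixes. This is why pseudo-inverses need to be compared only on the range of `A`. -/
theorem A_mul_pinv_mul_B (c : Fin (sk.rt (h + 1))) :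
    sk.A p h (2 * k) * pinv (sk.A p h (2 * k)) * sk.B p h k c = sk.B p h k c := by
  obtain ⟨W, hW⟩ := exists_eq_mul_of_forall_mem (M := sk.slice p h k c)
    fun y => of_mul_split_mem_colRange_left p h k (sk.T (h + 1) k) c y
  have : sk.B p h k c = (sk.S h (2 * k))ᵀ * unfolding p h (2 * k) * (W * sk.S h (2 * k + 1)) := by
    rw [B, hW]; simp only [Matrix.mul_assoc]
  rw [this, ← Matrix.mul_assoc, hl.A_mul_pinv_mul]

theorem sketched_mul_pinv_mul_slice (c : Fin (sk.rt (h + 1))) :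
    sk.sketched p h (2 * k) * pinv (sk.A p h (2 * k)) * ((sk.S h (2 * k))ᵀ * sk.slice p h k c)
      = sk.slice p h k c := by
  obtain ⟨W, hW⟩ := exists_eq_mul_of_forall_mem (M := sk.slice p h k c)
    fun y => of_mul_split_mem_colRange_left p h k (sk.T (h + 1) k) c y
  rw [hW, ← Matrix.mul_assoc _ _ W, ← Matrix.mul_assoc, hl.sketched_mul_pinv_mul]

omit hl
include hr

theorem A_mul_pinv_mul_B_transpose (c : Fin (sk.rt (h + 1))) :
    sk.A p h (2 * k + 1) * pinv (sk.A p h (2 * k + 1)) * (sk.B p h k c)ᵀ = (sk.B p h k c)ᵀ := by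
  obtain ⟨W, hW⟩ := exists_eq_mul_of_forall_mem (M := (sk.slice p h k c)ᵀ)
    fun x => of_mul_split_mem_colRange_right p h k (sk.T (h + 1) k) c x
  have : (sk.B p h k c)ᵀ
      = (sk.S h (2 * k + 1))ᵀ * unfolding p h (2 * k + 1) * (W * sk.S h (2 * k)) := by
    rw [B, Matrix.transpose_mul, Matrix.transpose_mul, hW]
    simp only [Matrix.mul_assoc, Matrix.transpose_transpose]
  rw [this, ← Matrix.mul_assoc, hr.A_mul_pinv_mul]

theorem sketched_mul_pinv_mul_slice_transpose (c : Fin (sk.rt (h + 1))) :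
    sk.sketched p h (2 * k + 1) * pinv (sk.A p h (2 * k + 1))
      * ((sk.S h (2 * k + 1))ᵀ * (sk.slice p h k c)ᵀ) = (sk.slice p h k c)ᵀ := by
  obtain ⟨W, hW⟩ := exists_eq_mul_of_forall_mem (M := (sk.slice p h k c)ᵀ)
    fun x => of_mul_split_mem_colRange_right p h k (sk.T (h + 1) k) c x
  rw [hW, ← Matrix.mul_assoc _ _ W, ← Matrix.mul_assoc, hr.sketched_mul_pinv_mul]

include hl

/-- The sketched function at a node is recovered from the ones at its children. -/
theorem slice_eq (c : Fin (sk.rt (h + 1))) :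
    sk.slice p h k c = sk.sketched p h (2 * k)
      * (pinv (sk.A p h (2 * k)) * sk.B p h k c * (pinv (sk.A p h (2 * k + 1)))ᵀ)
      * (sk.sketched p h (2 * k + 1))ᵀ := by
  have h1 := congrArg Matrix.transpose (hr.sketched_mul_pinv_mul_slice_transpose c)
  simp only [Matrix.transpose_mul, Matrix.transpose_transpose] at h1
  conv_lhs => rw [← hl.sketched_mul_pinv_mul_slice c, ← h1]
  simp only [B, Matrix.mul_assoc]

end Captures

/-- No variable lies outside the root cluster, so this sketch is the 1 × 1 identity. -/
theorem T_root_orthonormal : (sk.T L 0)ᵀ * sk.T L 0 = 1 := by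
  have hr := sk.rt_root
  have : IsEmpty {i : Fin (2 ^ L) // ¬ i.val / 2 ^ L = 0} :=
    ⟨fun i => i.2 (Nat.div_eq_of_lt i.1.2)⟩
  ext a b
  have hab : a = b := Fin.ext (by have := a.2; have := b.2; omega)
  rw [Matrix.mul_apply, hab]
  simp [sk.T_root]

/-- The function on the root cluster, as a function of all variables. -/
def rootEquiv : State n ≃ In n L 0 × Fin (sk.rt L) where
  toFun x := (rootPoint L x, ⟨0, by rw [sk.rt_root]; exact one_pos⟩)
  invFun q := fun i => q.1 ⟨i, Nat.div_eq_of_lt i.2⟩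
  left_inv _ := rfl
  right_inv q := Prod.ext rfl (Fin.ext (by have := q.2.2; have := sk.rt_root; simp; omega))

theorem sketched_root (p : State n → ℝ) (x : State n) (c : Fin (sk.rt L)) :
    sk.sketched p L 0 (rootPoint L x) c = p x := by
  have : IsEmpty {i : Fin (2 ^ L) // ¬ i.val / 2 ^ L = 0} :=
    ⟨fun i => i.2 (Nat.div_eq_of_lt i.1.2)⟩
  rw [sketched, Matrix.mul_apply]
  simp only [sk.T_root, mul_one, Fintype.sum_unique]
  refine congrArg p (funext fun i => ?_)
  simp [Equiv.piEquivPiSubtypeProd, rootPoint]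

/-! ### Elimination of the trimming bases; error of the best approximation -/

namespace Trimming

variable {sk} {p : State n → ℝ} (t : sk.Trimming p)

theorem recovered_succ_apply (h k : ℕ) (x : In n (h + 1) k) (c : Fin (sk.rt (h + 1))) :
    t.recovered (h + 1) k x c
      = (t.recovered h (2 * k) * t.G h k c * (t.recovered h (2 * k + 1))ᵀ)
        (split n h k x).1 (split n h k x).2 := rfl

/-- The columns of the pseudo-inverse lie in the range of `Pᵀ`, hence in that of `V`. Vanishing
singular values do no harm. -/
theorem V_mul_V_transpose_mul_pinv {h k : ℕ} (hh : h < L) (hk : k < 2 ^ (L - h)) :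
    t.V h k * ((t.V h k)ᵀ * pinv (t.P h k)) = pinv (t.P h k) := by
  have hX := pinv_isMoorePenrose (t.P h k)
  have h1 : pinv (t.P h k) = (t.P h k)ᵀ * ((pinv (t.P h k))ᵀ * pinv (t.P h k)) := by
    rw [← Matrix.mul_assoc, ← Matrix.transpose_mul, hX.symm_right, hX.mul_mul_right]
  have h2 : t.V h k * ((t.V h k)ᵀ * (t.P h k)ᵀ) = (t.P h k)ᵀ := by
    rw [P, Matrix.transpose_mul, Matrix.transpose_transpose, ← Matrix.mul_assoc (t.V h k)ᵀ,
      t.V_orth h k hh hk, Matrix.one_mul]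
  conv_lhs => rw [h1, ← Matrix.mul_assoc (t.V h k)ᵀ, ← Matrix.mul_assoc (t.V h k), h2]
  exact h1.symm

/-- On each edge below the node the product `V * Vᵀ` appears next to a core `G` and is absorbed by
the pseudo-inverse in it. Only the `V` on the upper leg survives. -/
theorem contract_C_eq {h : ℕ} : ∀ {k : ℕ}, h ≤ L → k < 2 ^ (L - h) →
    contract t.CLeaf t.C h k = t.recovered h k * t.V h k := by
  induction h with
  | zero => intros; rfl
  | succ h ih =>
    intro k hh hk
    have hpow : 2 ^ (L - h) = 2 * 2 ^ (L - (h + 1)) := by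
      rw [← pow_succ']; congr 1; omega
    have hkl : 2 * k < 2 ^ (L - h) := by omega
    have hkr : 2 * k + 1 < 2 ^ (L - h) := by omega
    have hG : ∀ g, t.V h (2 * k) * ((t.V h (2 * k))ᵀ * t.G h k g * t.V h (2 * k + 1))
        * (t.V h (2 * k + 1))ᵀ = t.G h k g := fun g => by
      have h1 := t.V_mul_V_transpose_mul_pinv hh hkl
      have h2 := congrArg Matrix.transpose (t.V_mul_V_transpose_mul_pinv hh hkr)
      simp only [Matrix.transpose_mul, Matrix.transpose_transpose] at h2
      rw [G, pinv_transpose]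
      calc _ = t.V h (2 * k) * ((t.V h (2 * k))ᵀ * pinv (t.P h (2 * k))) * sk.B p h k g
            * ((pinv (t.P h (2 * k + 1)))ᵀ * t.V h (2 * k + 1) * (t.V h (2 * k + 1))ᵀ) := by
            simp only [Matrix.mul_assoc]
        _ = _ := by rw [h1, h2]
    ext x c
    have hstep : contract t.CLeaf t.C (h + 1) k x c
        = (contract t.CLeaf t.C h (2 * k) * t.C h k c * (contract t.CLeaf t.C h (2 * k + 1))ᵀ)
          (split n h k x).1 (split n h k x).2 := rfl
    have hsum : contract t.CLeaf t.C h (2 * k) * t.C h k c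
          * (contract t.CLeaf t.C h (2 * k + 1))ᵀ
        = ∑ g, t.V (h + 1) k g c •
          (t.recovered h (2 * k) * t.G h k g * (t.recovered h (2 * k + 1))ᵀ) := by
      rw [ih (by omega) hkl, ih (by omega) hkr, C, Matrix.mul_sum, Matrix.sum_mul]
      refine Finset.sum_congr rfl fun g _ => ?_
      rw [Matrix.mul_smul, Matrix.smul_mul, Matrix.transpose_mul]
      conv_rhs => rw [← hG g]
      simp only [Matrix.mul_assoc]
    rw [hstep, hsum, Matrix.mul_apply, Matrix.sum_apply]
    refine Finset.sum_congr rfl fun g _ => ?_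
    rw [Matrix.smul_apply, smul_eq_mul, mul_comm, recovered_succ_apply]

theorem output_eq (x : State n) :
    t.output x = t.recovered L 0 (rootPoint L x) ⟨0, by rw [sk.rt_root]; exact one_pos⟩ := by
  have : Unique (Fin (sk.rt L)) :=
    { default := ⟨0, by rw [sk.rt_root]; exact one_pos⟩
      uniq := fun a => Fin.ext (by have := a.2; have := sk.rt_root; simp; omega) }
  rw [output, t.contract_C_eq le_rfl (by simp), Matrix.mul_apply, Fintype.sum_unique, t.V_root,
    mul_one]
  exact congrArg _ (Subsingleton.elim _ _)

theorem frob_output_sub (q : State n → ℝ) :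
    frob (fun x => t.output x - q x) = frobM (t.recovered L 0 - sk.sketched q L 0) := by
  rw [frobM, ← frob_comp_equiv sk.rootEquiv]
  congr 1
  funext x
  rw [output_eq, Matrix.sub_apply]
  congr 1
  exact (sk.sketched_root q x _).symm

/-- `M` competes in the best approximation, so the triangle inequality costs a factor 2. It is
applied with `M` the matrix `A` of the true density. -/
theorem specNorm_P_sub_le {h k : ℕ} (hh : h < L) (hk : k < 2 ^ (L - h))
    {M : Matrix (Fin (sk.rt h)) (Fin (sk.rt h)) ℝ} (hM : M.rank ≤ sk.r h) :
    specNorm (t.P h k - M) ≤ 2 * specNorm (sk.A p h k - M) := by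
  have h1 := t.best h k hh hk M hM
  change specNorm (sk.A p h k - t.P h k) ≤ _ at h1
  have h2 : t.P h k - M = (sk.A p h k - M) - (sk.A p h k - t.P h k) := by abel
  rw [h2]
  exact (specNorm_sub_le _ _).trans (by linarith)

/-- Without truncation the factor 2 of `specNorm_P_sub_le` is avoided. This matters when all sketch
sizes are 1, since then `√R` offers no slack. -/
theorem P_eq_of_le {h k : ℕ} (hh : h < L) (hk : k < 2 ^ (L - h)) (hr : sk.rt h ≤ sk.r h) :
    t.P h k = sk.A p h k := by
  have h1 := t.best h k hh hk (sk.A p h k)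
    ((Matrix.rank_le_width _).trans hr)
  rw [sub_self] at h1
  have h2 : specNorm (sk.A p h k - t.P h k) = 0 :=
    le_antisymm (h1.trans_eq specNorm_zero) (specNorm_nonneg _)
  exact (sub_eq_zero.mp (specNorm_eq_zero.mp h2)).symm

end Trimming

end Sketch

/-! ### Concentration of the empirical density -/

section Concentration

open scoped RealInnerProductSpace

variable {E : Type*} [NormedAddCommGroup E] [InnerProductSpace ℝ E]

/-- √(1 + ‖s‖²) is a smooth substitute for the norm. Concavity of the square root gives the linear
term, and its value being at least 1 bounds the quadratic term. -/
theorem sqrt_one_add_norm_add_sq_le (s x : E) :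
    √(1 + ‖s + x‖ ^ 2) ≤ √(1 + ‖s‖ ^ 2) + ⟪s, x⟫ / √(1 + ‖s‖ ^ 2) + ‖x‖ ^ 2 / 2 := by
  set g := √(1 + ‖s‖ ^ 2) with hg
  have hg2 : g ^ 2 = 1 + ‖s‖ ^ 2 := Real.sq_sqrt (by positivity)
  have hg1 : 1 ≤ g := Real.one_le_sqrt.mpr (by nlinarith [sq_nonneg ‖s‖])
  have hg0 : 0 < g := by linarith
  rw [norm_add_sq_real]
  have h1 : √(1 + (‖s‖ ^ 2 + 2 * ⟪s, x⟫ + ‖x‖ ^ 2))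
      ≤ g + (2 * ⟪s, x⟫ + ‖x‖ ^ 2) / (2 * g) := by
    have hnn : 0 ≤ 1 + (‖s‖ ^ 2 + 2 * ⟪s, x⟫ + ‖x‖ ^ 2) := by
      rw [← norm_add_sq_real]; positivity
    have he : g + (2 * ⟪s, x⟫ + ‖x‖ ^ 2) / (2 * g)
        = (g ^ 2 + (1 + (‖s‖ ^ 2 + 2 * ⟪s, x⟫ + ‖x‖ ^ 2))) / (2 * g) := by
      rw [hg2]; field_simp; rw [hg2]; ring
    rw [he, le_div_iff₀ (by positivity)]
    nlinarith [sq_nonneg (g - √(1 + (‖s‖ ^ 2 + 2 * ⟪s, x⟫ + ‖x‖ ^ 2))), Real.sq_sqrt hnn]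
  have h2 : (2 * ⟪s, x⟫ + ‖x‖ ^ 2) / (2 * g) = ⟪s, x⟫ / g + ‖x‖ ^ 2 / (2 * g) := by
    field_simp
  have h3 : ‖x‖ ^ 2 / (2 * g) ≤ ‖x‖ ^ 2 / 2 :=
    div_le_div_of_nonneg_left (by positivity) (by norm_num) (by linarith)
  linarith

variable {S : Type*} [Fintype S] {p : S → ℝ} {X : S → E} {v : ℝ}

/-- The term linear in `X a` has mean zero, so the increment costs `v / 2` from the quadratic term
and `v` from the second-order remainder of the exponential. -/
theorem sum_exp_sqrt_one_add_norm_le (hp : ∀ a, 0 ≤ p a) (hp1 : ∑ a, p a = 1)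
    (hX : ∑ a, p a • X a = 0) (hv : ∀ a, ‖X a‖ ^ 2 ≤ v) (hv1 : v ≤ 1) (s : E) :
    ∑ a, p a * Real.exp √(1 + ‖s + X a‖ ^ 2) ≤ Real.exp (√(1 + ‖s‖ ^ 2) + 3 / 2 * v) := by
  set g := √(1 + ‖s‖ ^ 2) with hg
  have hg0 : 0 < g := Real.sqrt_pos.mpr (by positivity)
  have hsg : ‖s‖ ≤ g := Real.le_sqrt_of_sq_le (by linarith)
  have hstep : ∀ a, Real.exp √(1 + ‖s + X a‖ ^ 2)
      ≤ Real.exp (g + v / 2) * (1 + ⟪s, X a⟫ / g + v) := fun a => by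
    have ht : (⟪s, X a⟫ / g) ^ 2 ≤ v := by
      have h1 : |⟪s, X a⟫| ≤ g * ‖X a‖ :=
        (abs_real_inner_le_norm _ _).trans (mul_le_mul_of_nonneg_right hsg (norm_nonneg _))
      rw [div_pow, div_le_iff₀ (by positivity)]
      calc ⟪s, X a⟫ ^ 2 = |⟪s, X a⟫| ^ 2 := (sq_abs _).symm
        _ ≤ (g * ‖X a‖) ^ 2 := pow_le_pow_left₀ (abs_nonneg _) h1 2
        _ = ‖X a‖ ^ 2 * g ^ 2 := by ring
        _ ≤ v * g ^ 2 := mul_le_mul_of_nonneg_right (hv a) (by positivity)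
    have ht1 : |⟪s, X a⟫ / g| ≤ 1 := by
      rw [← sq_le_one_iff_abs_le_one]; exact ht.trans hv1
    have he := (abs_le.mp (Real.abs_exp_sub_one_sub_id_le ht1)).2
    calc Real.exp √(1 + ‖s + X a‖ ^ 2) ≤ Real.exp (g + v / 2 + ⟪s, X a⟫ / g) := by
          refine Real.exp_le_exp.mpr ((sqrt_one_add_norm_add_sq_le s (X a)).trans ?_)
          have := hv a
          linarith
      _ = Real.exp (g + v / 2) * Real.exp (⟪s, X a⟫ / g) := Real.exp_add _ _
      _ ≤ _ := mul_le_mul_of_nonneg_left (by linarith) (Real.exp_pos _).le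
  have hmean : ∑ a, p a * (⟪s, X a⟫ / g) = 0 := by
    have : ∑ a, p a * ⟪s, X a⟫ = 0 := by
      simp_rw [← inner_smul_right]
      rw [← inner_sum, hX, inner_zero_right]
    simp_rw [← mul_div_assoc]
    rw [← Finset.sum_div, this, zero_div]
  calc ∑ a, p a * Real.exp √(1 + ‖s + X a‖ ^ 2)
      ≤ ∑ a, p a * (Real.exp (g + v / 2) * (1 + ⟪s, X a⟫ / g + v)) :=
        Finset.sum_le_sum fun a _ => mul_le_mul_of_nonneg_left (hstep a) (hp a)
    _ = Real.exp (g + v / 2) * ((1 + v) * ∑ a, p a + ∑ a, p a * (⟪s, X a⟫ / g)) := by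
        rw [Finset.mul_sum, ← Finset.sum_add_distrib, Finset.mul_sum]
        exact Finset.sum_congr rfl fun a _ => by ring
    _ = Real.exp (g + v / 2) * (1 + v) := by rw [hmean, hp1]; ring
    _ ≤ Real.exp (g + v / 2) * Real.exp v :=
        mul_le_mul_of_nonneg_left (by linarith [Real.add_one_le_exp v]) (Real.exp_pos _).le
    _ = _ := by rw [← Real.exp_add]; congr 1; ring

/-- The samples are peeled off one at a time; `s` is general because it absorbs those already taken.
-/
theorem sum_prod_exp_sqrt_one_add_norm_le (hp : ∀ a, 0 ≤ p a) (hp1 : ∑ a, p a = 1)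
    (hX : ∑ a, p a • X a = 0) (hv : ∀ a, ‖X a‖ ^ 2 ≤ v) (hv1 : v ≤ 1) (N : ℕ) (s : E) :
    ∑ y : Fin N → S, (∏ j, p (y j)) * Real.exp √(1 + ‖s + ∑ j, X (y j)‖ ^ 2)
      ≤ Real.exp (√(1 + ‖s‖ ^ 2) + N * (3 / 2 * v)) := by
  induction N generalizing s with
  | zero => simp
  | succ N ih =>
    rw [← (Fin.consEquiv fun _ : Fin (N + 1) => S).sum_comp, Fintype.sum_prod_type]
    simp only [Fin.consEquiv_apply, Fin.prod_univ_succ, Fin.sum_univ_succ, Fin.cons_zero,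
      Fin.cons_succ, mul_assoc, ← Finset.mul_sum, ← add_assoc]
    calc _ ≤ ∑ a, p a * Real.exp (√(1 + ‖s + X a‖ ^ 2) + N * (3 / 2 * v)) :=
          Finset.sum_le_sum fun a _ => mul_le_mul_of_nonneg_left (ih (s + X a)) (hp a)
      _ = (∑ a, p a * Real.exp √(1 + ‖s + X a‖ ^ 2)) * Real.exp (N * (3 / 2 * v)) := by
          rw [Finset.sum_mul]
          exact Finset.sum_congr rfl fun a _ => by rw [Real.exp_add, mul_assoc]
      _ ≤ Real.exp (√(1 + ‖s‖ ^ 2) + 3 / 2 * v) * Real.exp (N * (3 / 2 * v)) :=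
          mul_le_mul_of_nonneg_right (sum_exp_sqrt_one_add_norm_le hp hp1 hX hv hv1 s)
            (Real.exp_pos _).le
      _ = _ := by rw [← Real.exp_add]; congr 1; push_cast; ring

/-- Dimension-free concentration of the empirical density in the Frobenius norm, as a bound for
sums over all samples. -/
theorem sum_prod_frob_gt_le [DecidableEq S] (hp : ∀ a, 0 ≤ p a) (hp1 : ∑ a, p a = 1) {N : ℕ}
    (hN : 1 ≤ N) (u : ℝ) :
    ∑ y : Fin N → S with 3 * u / √N
        < frob (fun x => 1 / (N : ℝ) * (∑ j, if y j = x then 1 else 0) - p x), ∏ j, p (y j)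
      ≤ Real.exp (4 / 3 - u) := by
  classical
  have hN0 : (0 : ℝ) < N := by exact_mod_cast hN
  have hsN : (√N) ^ 2 = N := Real.sq_sqrt hN0.le
  have hsN0 : 0 < √(N : ℝ) := Real.sqrt_pos.mpr hN0
  -- With this scaling the bad event says that the sum of the `X (y j)` has norm above `u`. The
  -- squared norm of each `X a` is at most `2 / (9 * N)`, so the exponent is 1 + 1/3 = 4/3.
  set c : ℝ := 1 / (3 * √N) with hc
  have hc0 : 0 < c := by positivity
  let X : S → EuclideanSpace ℝ S := fun a =>
    c • WithLp.toLp 2 (fun x => (if a = x then 1 else 0) - p x)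
  have hple : ∀ a, p a ≤ 1 := fun a =>
    hp1 ▸ Finset.single_le_sum (fun b _ => hp b) (Finset.mem_univ a)
  have hX : ∑ a, p a • X a = 0 := by
    ext x
    simp only [X, WithLp.ofLp_sum, WithLp.ofLp_smul, Finset.sum_apply, Pi.smul_apply, smul_eq_mul,
      WithLp.ofLp_zero, Pi.zero_apply]
    have : ∑ a, p a * (c * ((if a = x then 1 else 0) - p x))
        = c * (∑ a, (if a = x then p a else 0) - (∑ a, p a) * p x) := by
      rw [Finset.sum_mul, ← Finset.sum_sub_distrib, Finset.mul_sum]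
      exact Finset.sum_congr rfl fun a _ => by split_ifs <;> ring
    rw [this, hp1]
    simp
  have hnorm : ∀ a, ‖X a‖ ^ 2 ≤ 2 / (9 * N) := fun a => by
    have h1 : ∑ x, ((if a = x then 1 else 0) - p x) ^ 2 ≤ 2 := by
      have : ∀ x, ((if a = x then 1 else 0) - p x) ^ 2 ≤ (if a = x then 1 else 0) + p x := by
        intro x
        have := hp x
        have := hple x
        split_ifs <;> nlinarith
      refine (Finset.sum_le_sum fun x _ => this x).trans ?_
      rw [Finset.sum_add_distrib, hp1]
      simp; norm_num
    simp only [X]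
    rw [norm_smul, mul_pow, ← frob_eq_norm, frob_sq, Real.norm_of_nonneg hc0.le]
    have hc2 : c ^ 2 = 1 / (9 * N) := by
      rw [hc, div_pow, mul_pow, hsN]; norm_num
    rw [hc2]
    calc _ ≤ 1 / (9 * (N : ℝ)) * 2 := mul_le_mul_of_nonneg_left h1 (by positivity)
      _ = _ := by ring
  have hv1 : 2 / (9 * (N : ℝ)) ≤ 1 := by
    rw [div_le_one (by positivity)]
    have : (1 : ℝ) ≤ N := by exact_mod_cast hN
    linarith
  have key := sum_prod_exp_sqrt_one_add_norm_le hp hp1 hX hnorm hv1 N 0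
  have hexp : √(1 + ‖(0 : EuclideanSpace ℝ S)‖ ^ 2) + N * (3 / 2 * (2 / (9 * (N : ℝ)))) = 4 / 3 := by
    rw [norm_zero]
    have : (N : ℝ) * (3 / 2 * (2 / (9 * (N : ℝ)))) = 1 / 3 := by field_simp; norm_num
    rw [this]; norm_num
  rw [hexp] at key
  -- Markov's inequality: on the bad event the exponential is at least `exp u`.
  rw [Real.exp_sub, le_div_iff₀ (Real.exp_pos _), Finset.sum_mul]
  refine le_trans ?_ key
  refine (Finset.sum_le_sum fun y hy => ?_).trans
    (Finset.sum_le_sum_of_subset_of_nonneg (Finset.filter_subset _ _) fun y _ _ => ?_)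
  · refine mul_le_mul_of_nonneg_left (Real.exp_le_exp.mpr ?_) (Finset.prod_nonneg fun j _ => hp _)
    rw [Finset.mem_filter] at hy
    have h1 : ∑ j, X (y j) = (c * N) • WithLp.toLp 2
        (fun x => 1 / (N : ℝ) * (∑ j, if y j = x then 1 else 0) - p x) := by
      ext x
      simp only [X, WithLp.ofLp_sum, WithLp.ofLp_smul, Finset.sum_apply, Pi.smul_apply, smul_eq_mul]
      rw [← Finset.mul_sum, Finset.sum_sub_distrib, Finset.sum_const, Finset.card_univ,
        Fintype.card_fin, nsmul_eq_mul]
      field_simp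
    rw [zero_add, h1, norm_smul, ← frob_eq_norm, Real.norm_of_nonneg (by positivity)]
    refine le_trans ?_ (Real.le_sqrt_of_sq_le (le_add_of_nonneg_left zero_le_one))
    have hcN : c * N = √N / 3 := by
      rw [hc]; field_simp; exact hsN.symm
    have hu : u = √N / 3 * (3 * u / √N) := by field_simp
    rw [hcN]
    conv_lhs => rw [hu]
    exact mul_le_mul_of_nonneg_left hy.2.le (by positivity)
  · exact mul_nonneg (Finset.prod_nonneg fun j _ => hp _) (Real.exp_pos _).le

/-- Concentration of the empirical density of a sample. -/
theorem one_sub_exp_le_measureReal_frob_le [DecidableEq S] [MeasurableSpace S]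
    [MeasurableSingletonClass S] (hp : ∀ a, 0 ≤ p a) (hp1 : ∑ a, p a = 1) {N : ℕ} (hN : 1 ≤ N)
    {Ω : Type*} [MeasurableSpace Ω] (μ : Measure Ω) [IsProbabilityMeasure μ] (Y : Fin N → Ω → S)
    (hY_indep : iIndepFun Y μ) (hY_law : ∀ j x, μ.real {ω | Y j ω = x} = p x) (u : ℝ) :
    1 - Real.exp (4 / 3 - u) ≤ μ.real {ω |
      frob (fun x => 1 / (N : ℝ) * (∑ j, if Y j ω = x then 1 else 0) - p x) ≤ 3 * u / √N} := by
  classical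
  set good := {ω | frob (fun x => 1 / (N : ℝ) * (∑ j, if Y j ω = x then 1 else 0) - p x)
    ≤ 3 * u / √N} with hgood
  set bad : Finset (Fin N → S) := {y | 3 * u / √N
    < frob (fun x => 1 / (N : ℝ) * (∑ j, if y j = x then 1 else 0) - p x)} with hbad
  -- Subadditivity on a cover is used in place of the complement rule, so measurability of the good
  -- event plays no role.
  have hcover : good ∪ ⋃ y ∈ bad, {ω | ∀ j, Y j ω = y j} = Set.univ := by
    refine Set.eq_univ_of_forall fun ω => ?_
    by_cases h : ω ∈ good
    · exact Or.inl h
    · refine Or.inr (Set.mem_biUnion (x := fun j => Y j ω) ?_ fun j => rfl)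
      simpa [hbad, hgood] using h
  have hjoint : ∀ y : Fin N → S, μ.real {ω | ∀ j, Y j ω = y j} = ∏ j, p (y j) := fun y => by
    have h1 := hY_indep.measure_inter_preimage_eq_mul Finset.univ (sets := fun j => {y j})
      (fun j _ => measurableSet_singleton _)
    have h2 : {ω | ∀ j, Y j ω = y j} = ⋂ j ∈ Finset.univ, Y j ⁻¹' {y j} := by
      ext ω; simp
    rw [h2, measureReal_def, h1, ENNReal.toReal_prod]
    exact Finset.prod_congr rfl fun j _ => hY_law j (y j)
  have h1 : 1 ≤ μ.real good + ∑ y ∈ bad, μ.real {ω | ∀ j, Y j ω = y j} := by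
    calc (1 : ℝ) = μ.real Set.univ := by simp
      _ ≤ _ := by
        rw [← hcover]
        exact (measureReal_union_le _ _).trans
          (add_le_add_right (measureReal_biUnion_finset_le _ _) _)
  simp_rw [hjoint] at h1
  have h2 := sum_prod_frob_gt_le hp hp1 hN u
  linarith

end Concentration

/-! ### Error propagation through one level -/

section Step

variable {α β m γ : Type*} [Fintype α] [Fintype β] [Fintype m] [Fintype γ]
  [DecidableEq α] [DecidableEq β] [DecidableEq m]

theorem frobT_mul_mul_mul_mul_le (X : Matrix α m ℝ) (M : Matrix m m ℝ) (F : γ → Matrix m m ℝ)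
    (N : Matrix m m ℝ) (Z : Matrix β m ℝ) {x y f w z : ℝ} (hX : frobM X ≤ x) (hM : specNorm M ≤ y)
    (hF : frobT F ≤ f) (hN : specNorm N ≤ w) (hZ : frobM Z ≤ z) :
    frobT (fun c => X * (M * F c * Nᵀ) * Zᵀ) ≤ x * (y * f * w) * z := by
  have hx0 : 0 ≤ x := (frobM_nonneg _).trans hX
  have hy0 : 0 ≤ y := (specNorm_nonneg _).trans hM
  have hw0 : 0 ≤ w := (specNorm_nonneg _).trans hN
  have hz0 : 0 ≤ z := (frobM_nonneg _).trans hZ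
  have hN' : specNorm Nᵀ ≤ w := by rwa [specNorm_transpose]
  have hZ' : specNorm Zᵀ ≤ z := by rw [specNorm_transpose]; exact (specNorm_le_frobM Z).trans hZ
  refine (frobT_mul_mul_le X (fun c => M * F c * Nᵀ) Zᵀ ((specNorm_le_frobM X).trans hX)
    hZ').trans ?_
  gcongr
  refine (frobT_mul_mul_le M F Nᵀ hM hN').trans ?_
  gcongr

/-- Five factors are exchanged one by one: `B`, the two pseudo-inverses, the two children. The
hypotheses on `DL` and `DR` replace a difference of pseudo-inverses, which may be large, by a matrix
that acts equally on `Bs` and is small. -/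
theorem frobT_contract_sub_le {pL pL' : Matrix α m ℝ} {pR pR' : Matrix β m ℝ}
    {Bh Bs : γ → Matrix m m ℝ} {YL XL YR XR DL DR : Matrix m m ℝ} {a b q s e ε κ : ℝ}
    (hpL : frobM pL ≤ s) (hpR : frobM pR ≤ s) (hpL' : frobM pL' ≤ q)
    (heL : frobM (pL - pL') ≤ e) (heR : frobM (pR - pR') ≤ e)
    (hYL : specNorm YL ≤ b) (hYR : specNorm YR ≤ b) (hXL : specNorm XL ≤ a) (hXR : specNorm XR ≤ a)
    (hBs : frobT Bs ≤ q) (hB : frobT (fun c => Bh c - Bs c) ≤ ε)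
    (hDL : ∀ c, (YL - XL) * Bs c = DL * Bs c) (hDR : ∀ c, Bs c * (YR - XR)ᵀ = Bs c * DRᵀ)
    (hκL : specNorm DL ≤ κ) (hκR : specNorm DR ≤ κ) :
    frobT (fun c => pL * (YL * Bh c * YRᵀ) * pRᵀ - pL' * (XL * Bs c * XRᵀ) * pR'ᵀ)
      ≤ (a ^ 2 * q * s + a ^ 2 * q ^ 2) * e + s ^ 2 * (b ^ 2 * ε + κ * q * b + a * q * κ) := by
  have hsplit : ∀ c, pL * (YL * Bh c * YRᵀ) * pRᵀ - pL' * (XL * Bs c * XRᵀ) * pR'ᵀ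
      = pL * (YL * (Bh c - Bs c) * YRᵀ) * pRᵀ + (pL * (DL * Bs c * YRᵀ) * pRᵀ
        + (pL * (XL * Bs c * DRᵀ) * pRᵀ + ((pL - pL') * (XL * Bs c * XRᵀ) * pRᵀ
        + pL' * (XL * Bs c * XRᵀ) * (pR - pR')ᵀ))) := fun c => by
    have h1 := hDR c
    rw [Matrix.mul_assoc XL (Bs c) DRᵀ, ← h1, ← hDL c]
    simp only [Matrix.mul_sub, Matrix.sub_mul, Matrix.transpose_sub, Matrix.mul_assoc]
    abel
  simp only [hsplit]
  have h1 := frobT_mul_mul_mul_mul_le pL YL (fun c => Bh c - Bs c) YR pR hpL hYL hB hYR hpR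
  have h2 := frobT_mul_mul_mul_mul_le pL DL Bs YR pR hpL hκL hBs hYR hpR
  have h3 := frobT_mul_mul_mul_mul_le pL XL Bs DR pR hpL hXL hBs hκR hpR
  have h4 := frobT_mul_mul_mul_mul_le (pL - pL') XL Bs XR pR heL hXL hBs hXR hpR
  have h5 := frobT_mul_mul_mul_mul_le pL' XL Bs XR (pR - pR') hpL' hXL hBs hXR heR
  refine (frobT_add_le _ _).trans ((add_le_add h1 ((frobT_add_le _ _).trans (add_le_add h2
    ((frobT_add_le _ _).trans (add_le_add h3 ((frobT_add_le _ _).trans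
      (add_le_add h4 h5))))))).trans_eq ?_)
  ring

theorem one_le_specNorm_mul_of_isMoorePenrose {A X : Matrix m m ℝ} (h : IsMoorePenrose A X)
    (hA : A ≠ 0) : 1 ≤ specNorm X * specNorm A := by
  have h0 : 0 < specNorm A :=
    (specNorm_nonneg A).lt_of_ne fun h0 => hA (specNorm_eq_zero.mp h0.symm)
  have h1 : specNorm A ≤ specNorm A * specNorm X * specNorm A := by
    conv_lhs => rw [← h.mul_mul_left]
    exact (specNorm_mul_le _ _).trans
      (mul_le_mul_of_nonneg_right (specNorm_mul_le _ _) (specNorm_nonneg _))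
  nlinarith

/-- If the perturbation is so large that it may change the rank of a pseudo-inverted matrix, then
the error bound for one level exceeds the norm of the approximated function. -/
theorem le_growth_mul_sqrt_mul {a q s ε R : ℝ} (hs : 0 ≤ s) (hε : 0 ≤ ε) (ha : 0 ≤ a)
    (haq : 1 ≤ a * q) (has : 1 - a * ε ≤ a * s) (hR : 1 ≤ R)
    (h : 1 ≤ a * ε ∨ 2 ≤ R ∧ 1 ≤ a * (2 * ε)) :
    q ≤ growth a q s * (√R * ε) := by
  have hq : 0 ≤ q := by
    by_contra hq
    nlinarith
  have hR1 : 1 ≤ √R := Real.one_le_sqrt.mpr hR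
  have hτ : 0 ≤ a * ε := mul_nonneg ha hε
  have has0 : 0 ≤ a * s := mul_nonneg ha hs
  have key : 1 ≤ √R * (a * ε) * (a * s + a * q) := by
    by_cases h1 : 1 ≤ a * ε
    · have h2 : 1 ≤ √R * (a * ε) := one_le_mul_of_one_le_of_one_le hR1 h1
      exact one_le_mul_of_one_le_of_one_le h2 (by linarith)
    · obtain h | ⟨hR2, h2⟩ := h
      · exact absurd h h1
      push Not at h1
      -- Here `a * ε` lies in [1/2, 1), where t(2 - t) ≥ 3/4, and 7/5 · 3/4 > 1. The rational bound
      -- for √2 is enough.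
      have hR3 : 7 / 5 ≤ √R := Real.le_sqrt_of_sq_le (by linarith)
      have h3 : 1 ≤ 7 / 5 * (a * ε) * (2 - a * ε) := by nlinarith
      refine h3.trans ?_
      have h4 : 2 - a * ε ≤ a * s + a * q := by linarith
      have : 0 ≤ 2 - a * ε := by linarith
      gcongr
  calc q = q * 1 := (mul_one q).symm
    _ ≤ q * (√R * (a * ε) * (a * s + a * q)) := mul_le_mul_of_nonneg_left key hq
    _ = _ := by rw [growth]; ring

end Step

theorem eq_zero_of_rank_eq_zero {α β : Type*} [Fintype β] [DecidableEq β]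
    {M : Matrix α β ℝ} (h : M.rank = 0) : M = 0 := by
  have h1 : LinearMap.range M.mulVecLin = ⊥ := Submodule.finrank_eq_zero.mp h
  rw [LinearMap.range_eq_bot] at h1
  ext a b
  have := congrFun (LinearMap.congr_fun h1 (Pi.single b 1)) a
  simpa using this

/-! ### One level of the tree -/

namespace Sketch

variable {L : ℕ} {n : Fin (2 ^ L) → ℕ} {sk : Sketch L n}

theorem specNorm_A_sub_le {h k : ℕ} (hS : (sk.S h k)ᵀ * sk.S h k = 1)
    (hT : (sk.T h k)ᵀ * sk.T h k = 1) (p q : State n → ℝ) :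
    specNorm (sk.A p h k - sk.A q h k) ≤ frob (fun x => p x - q x) := by
  rw [A, A, ← Matrix.mul_sub, sketched_sub]
  calc _ ≤ _ := specNorm_le_frobM _
    _ ≤ specNorm (sk.S h k)ᵀ * frobM (sk.sketched (fun x => p x - q x) h k) :=
      frobM_mul_le_left _ _
    _ ≤ 1 * frob (fun x => p x - q x) := by
      refine mul_le_mul ?_ (sk.frobM_sketched_le hT _) (frobM_nonneg _) zero_le_one
      rw [specNorm_transpose]
      exact specNorm_le_one_of_orthonormal hS
    _ = _ := one_mul _

theorem specNorm_A_le {h k : ℕ} (hS : (sk.S h k)ᵀ * sk.S h k = 1) (p : State n → ℝ) :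
    specNorm (sk.A p h k) ≤ frobM (sk.sketched p h k) := by
  rw [A]
  refine (specNorm_le_frobM _).trans ((frobM_mul_le_left _ _).trans ?_)
  rw [specNorm_transpose]
  exact mul_le_of_le_one_left (frobM_nonneg _) (specNorm_le_one_of_orthonormal hS)

namespace Trimming

variable {p q : State n → ℝ} (t : sk.Trimming p)

theorem frobM_recovered_succ_sub (q : State n → ℝ) (h k : ℕ) :
    frobM (t.recovered (h + 1) k - sk.sketched q (h + 1) k)
      = frobT (fun c => t.recovered h (2 * k) * t.G h k c * (t.recovered h (2 * k + 1))ᵀ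
        - sk.slice q h k c) := by
  rw [frobM, frobT, ← frob_comp_equiv
    ((Equiv.prodComm _ _).trans (Equiv.prodCongr (split n h k).symm (Equiv.refl _)))]
  congr 1
  funext c
  change t.recovered (h + 1) k ((split n h k).symm c.2) c.1
    - sk.sketched q (h + 1) k ((split n h k).symm c.2) c.1 = _
  rw [recovered_succ_apply, Equiv.apply_symm_apply]
  rfl

/-- Error propagation from the children of a node to the node. -/
theorem frobM_recovered_succ_sub_le {h k : ℕ} (hh : h < L) (hkl : 2 * k < 2 ^ (L - h))
    (hkr : 2 * k + 1 < 2 ^ (L - h))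
    (hS : ∀ k, k < 2 ^ (L - h) → (sk.S h k)ᵀ * sk.S h k = 1)
    (hT : ∀ k, k < 2 ^ (L - h) → (sk.T h k)ᵀ * sk.T h k = 1)
    (hTp : (sk.T (h + 1) k)ᵀ * sk.T (h + 1) k = 1)
    (hcap : ∀ k, k < 2 ^ (L - h) → sk.Captures q h k)
    (hrank : ∀ k, k < 2 ^ (L - h) → (sk.A q h k).rank ≤ sk.r h)
    {R : ℕ} (hR1 : 1 ≤ R) (hR : sk.rt h ≤ R) (hr : 1 ≤ sk.r h)
    {cA cp cAhat cpt ε e : ℝ}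
    (hcA : ∀ k, k < 2 ^ (L - h) → specNorm (pinv (sk.A q h k)) ≤ cA)
    (hcp : ∀ k, k < 2 ^ (L - h) → frobM (sk.sketched q h k) ≤ cp)
    (hcpp : frobM (sk.sketched q (h + 1) k) ≤ cp)
    (hcAhat : ∀ k, k < 2 ^ (L - h) → specNorm (pinv (t.P h k)) ≤ cAhat)
    (hcpt : ∀ k, k < 2 ^ (L - h) → frobM (t.recovered h k) ≤ cpt)
    (hε : frob (fun x => p x - q x) ≤ ε)
    (hcAcp : 1 ≤ cA * cp) (hcAcpt : 1 - cA * ε ≤ cA * cpt)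
    (he : ∀ k, k < 2 ^ (L - h) → frobM (t.recovered h k - sk.sketched q h k) ≤ e)
    (heε : √R * ε ≤ e) (hg : 0 ≤ growth cA cp cpt) :
    frobM (t.recovered (h + 1) k - sk.sketched q (h + 1) k)
      ≤ growth cA cp cpt * e
        + cpt ^ 2 * (cAhat ^ 2 + 6 * cA * cAhat ^ 2 * cp + 6 * cA ^ 2 * cAhat * cp) * (√R * ε) := by
  have hε0 : 0 ≤ ε := (frob_nonneg _).trans hε
  have hcA0 : 0 ≤ cA := (specNorm_nonneg _).trans (hcA _ hkl)
  have hcp0 : 0 ≤ cp := (frobM_nonneg _).trans (hcp _ hkl)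
  have hb0 : 0 ≤ cAhat := (specNorm_nonneg _).trans (hcAhat _ hkl)
  have hs0 : 0 ≤ cpt := (frobM_nonneg _).trans (hcpt _ hkl)
  have hsR : 1 ≤ √(R : ℝ) := Real.one_le_sqrt.mpr (by exact_mod_cast hR1)
  have hεR : ε ≤ √R * ε := le_mul_of_one_le_left hε0 hsR
  have hBs : frobT (sk.B q h k) ≤ cp := (sk.frobT_B_le (hS _ hkl) (hS _ hkr) q).trans hcpp
  have hB : frobT (fun c => sk.B p h k c - sk.B q h k c) ≤ ε := by
    simp only [B_sub]
    exact (sk.frobT_B_le (hS _ hkl) (hS _ hkr) _).trans ((sk.frobM_sketched_le hTp _).trans hε)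
  have hA : ∀ j, j < 2 ^ (L - h) → specNorm (sk.A p h j - sk.A q h j) ≤ ε := fun j hj =>
    (specNorm_A_sub_le (hS j hj) (hT j hj) p q).trans hε
  rw [frobM_recovered_succ_sub]
  -- Either the perturbation of `A` is small against `1 / cA` and perturbation theory applies, or ε
  -- is large and crude bounds suffice. The choices that matter are `2 * ε` in general and `ε`
  -- without truncation.
  by_cases hη : ∃ η ≤ 2 * ε, cA * η < 1 ∧
      ∀ j, j < 2 ^ (L - h) → specNorm (t.P h j - sk.A q h j) ≤ η
  · obtain ⟨η, hη2, hη1, hη⟩ := hη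
    have hpert : ∀ j, j < 2 ^ (L - h) → specNorm (pinv (t.P h j) * sk.A q h j * pinv (sk.A q h j)
        - pinv (sk.A q h j)) ≤ 2 * cA * cAhat * η := fun j hj =>
      specNorm_mul_mul_sub_le (pinv_isMoorePenrose _) (pinv_isMoorePenrose _) (hcA j hj)
        (hcAhat j hj) (hη j hj) hη1
    have hmain := frobT_contract_sub_le (hcpt _ hkl) (hcpt _ hkr) (hcp _ hkl) (he _ hkl) (he _ hkr)
      (hcAhat _ hkl) (hcAhat _ hkr) (hcA _ hkl) (hcA _ hkr) hBs hB
      (fun c => by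
        rw [Matrix.sub_mul, Matrix.sub_mul, Matrix.mul_assoc (_ * _), Matrix.mul_assoc,
          ← Matrix.mul_assoc (sk.A q h (2 * k)), (hcap _ hkl).A_mul_pinv_mul_B])
      (fun c => by
        rw [← Matrix.transpose_transpose (sk.B q h k c), ← Matrix.transpose_mul,
          ← Matrix.transpose_mul, Matrix.sub_mul, Matrix.sub_mul, Matrix.mul_assoc (_ * _),
          Matrix.mul_assoc, ← Matrix.mul_assoc (sk.A q h (2 * k + 1)),
          (hcap _ hkr).A_mul_pinv_mul_B_transpose])
      (hpert _ hkl) (hpert _ hkr)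
    have heq : ∀ c, t.recovered h (2 * k) * t.G h k c * (t.recovered h (2 * k + 1))ᵀ
        - sk.slice q h k c = t.recovered h (2 * k) * (pinv (t.P h (2 * k)) * sk.B p h k c
          * (pinv (t.P h (2 * k + 1)))ᵀ) * (t.recovered h (2 * k + 1))ᵀ
          - sk.sketched q h (2 * k) * (pinv (sk.A q h (2 * k)) * sk.B q h k c
            * (pinv (sk.A q h (2 * k + 1)))ᵀ) * (sk.sketched q h (2 * k + 1))ᵀ := fun c => by
      rw [G, pinv_transpose, ← (hcap _ hkl).slice_eq (hcap _ hkr)]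
    simp only [heq]
    refine hmain.trans ?_
    -- With `η ≤ 2 * ε` the two mixed terms get coefficient 4; the 6 leaves room.
    have h1 : cAhat ^ 2 * ε + 2 * cA * cAhat * η * cp * cAhat + cA * cp * (2 * cA * cAhat * η)
        ≤ (cAhat ^ 2 + 6 * cA * cAhat ^ 2 * cp + 6 * cA ^ 2 * cAhat * cp) * ε := by
      have h2 : 2 * (cA * cAhat ^ 2 * cp + cA ^ 2 * cAhat * cp) * η
          ≤ 2 * (cA * cAhat ^ 2 * cp + cA ^ 2 * cAhat * cp) * (2 * ε) := by gcongr
      have h3 : 0 ≤ (cA * cAhat ^ 2 * cp + cA ^ 2 * cAhat * cp) * ε := by positivity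
      linarith
    have h4 : (cAhat ^ 2 + 6 * cA * cAhat ^ 2 * cp + 6 * cA ^ 2 * cAhat * cp) * ε
        ≤ (cAhat ^ 2 + 6 * cA * cAhat ^ 2 * cp + 6 * cA ^ 2 * cAhat * cp) * (√R * ε) := by gcongr
    rw [mul_assoc (cpt ^ 2)]
    exact add_le_add_right (mul_le_mul_of_nonneg_left (h1.trans h4) (by positivity)) _
  · push Not at hη
    have htriv : 1 ≤ cA * ε ∨ (2 : ℝ) ≤ R ∧ 1 ≤ cA * (2 * ε) := by
      by_contra hcon
      push Not at hcon
      obtain hR2 | hR2 := le_or_gt 2 R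
      · obtain ⟨j, hj, hj'⟩ := hη (2 * ε) le_rfl (hcon.2 (by exact_mod_cast hR2))
        have := t.specNorm_P_sub_le hh hj (hrank j hj)
        linarith [hA j hj]
      -- Now `R = 1`, so the sketch size does not exceed the rank, nothing is truncated, and `ε`
      -- itself is admissible.
      · obtain ⟨j, hj, hj'⟩ := hη ε (by linarith) hcon.1
        rw [t.P_eq_of_le hh hj (by omega)] at hj'
        linarith [hA j hj]
    have hq := le_growth_mul_sqrt_mul hs0 hε0 hcA0 hcAcp hcAcpt (R := R) (by exact_mod_cast hR1)
      htriv
    -- As `ε` is at least `1 / (2 * cA)`, constants become multiples of `ε`. The recovered function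
    -- is then absorbed by the additive term, and the true slice by the `growth` term through `hq`.
    have hcpε : cp ≤ 2 * cA * cp * ε := by
      have : 1 ≤ 2 * cA * ε := by
        obtain h1 | h1 := htriv
        · linarith
        · linarith [h1.2]
      nlinarith
    have h1 : frobT (fun c => t.recovered h (2 * k) * t.G h k c * (t.recovered h (2 * k + 1))ᵀ)
        ≤ cpt * (cAhat * (cp + ε) * cAhat) * cpt := by
      simp only [G, pinv_transpose]
      exact frobT_mul_mul_mul_mul_le _ _ _ _ _ (hcpt _ hkl) (hcAhat _ hkl)
        ((frobT_le_add_frobT_sub _ _).trans (add_le_add hBs hB)) (hcAhat _ hkr) (hcpt _ hkr)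
    refine (frobT_sub_le _ _).trans ?_
    rw [frobT_slice]
    have h2 : cpt * (cAhat * (cp + ε) * cAhat) * cpt
        ≤ cpt ^ 2 * (cAhat ^ 2 + 6 * cA * cAhat ^ 2 * cp + 6 * cA ^ 2 * cAhat * cp) * (√R * ε) := by
      calc cpt * (cAhat * (cp + ε) * cAhat) * cpt = cpt ^ 2 * (cAhat ^ 2 * (cp + ε)) := by ring
        _ ≤ cpt ^ 2 * ((cAhat ^ 2 + 6 * cA * cAhat ^ 2 * cp + 6 * cA ^ 2 * cAhat * cp) * ε) := by
          refine mul_le_mul_of_nonneg_left ?_ (sq_nonneg _)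
          have h3 : cAhat ^ 2 * cp ≤ cAhat ^ 2 * (2 * cA * cp * ε) := by gcongr
          have h4 : 0 ≤ cA * cAhat ^ 2 * cp * ε := by positivity
          have h5 : 0 ≤ cA ^ 2 * cAhat * cp * ε := by positivity
          linarith
        _ ≤ cpt ^ 2 * ((cAhat ^ 2 + 6 * cA * cAhat ^ 2 * cp + 6 * cA ^ 2 * cAhat * cp)
            * (√R * ε)) := by gcongr
        _ = _ := by ring
    have h3 : growth cA cp cpt * (√R * ε) ≤ growth cA cp cpt * e := by gcongr
    linarith

end Trimming

end Sketch

/-- Deterministic error bound: the output of the algorithm depends stably on its input. -/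
theorem frob_output_sub_le {L : ℕ} (hL : 1 ≤ L) {n : Fin (2 ^ L) → ℕ} {p q : State n → ℝ}
    (hq : q ≠ 0) (sk : Sketch L n)
    (hS : ∀ h k, h < L → k < 2 ^ (L - h) → (sk.S h k)ᵀ * sk.S h k = 1)
    (hT : ∀ h k, h < L → k < 2 ^ (L - h) → (sk.T h k)ᵀ * sk.T h k = 1)
    (hrank : ∀ h k, h < L → k < 2 ^ (L - h) → (unfolding q h k).rank ≤ sk.r h)
    (hcap : ∀ h k, h < L → k < 2 ^ (L - h) → sk.Captures q h k)
    {R : ℕ} (hR1 : 1 ≤ R) (hR : ∀ h, h < L → sk.rt h ≤ R)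
    {cA cp cAhat cpt ε : ℝ}
    (hcA : ∀ h k, h < L → k < 2 ^ (L - h) → specNorm (pinv (sk.A q h k)) ≤ cA)
    (hcp : ∀ h k, h < L → k < 2 ^ (L - h) → frobM (sk.sketched q h k) ≤ cp)
    (hcp0 : frob q ≤ cp) (t : sk.Trimming p)
    (hcAhat : ∀ h k, h < L → k < 2 ^ (L - h) → specNorm (pinv (t.P h k)) ≤ cAhat)
    (hcpt : ∀ h k, h < L → k < 2 ^ (L - h) → frobM (t.recovered h k) ≤ cpt)
    (hε : frob (fun x => p x - q x) ≤ ε) (hg : 1 < growth cA cp cpt) :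
    frob (fun x => t.output x - q x) ≤ (1 + cpt ^ 2 * (cAhat ^ 2 + 6 * cA * cAhat ^ 2 * cp
      + 6 * cA ^ 2 * cAhat * cp) / (growth cA cp cpt - 1)) * growth cA cp cpt ^ L * (√R * ε) := by
  have hε0 : 0 ≤ ε := (frob_nonneg _).trans hε
  have h00 : 0 < 2 ^ (L - 0) := by positivity
  have hcA0 : 0 ≤ cA := (specNorm_nonneg _).trans (hcA 0 0 hL h00)
  have hb0 : 0 ≤ cAhat := (specNorm_nonneg _).trans (hcAhat 0 0 hL h00)
  have hcp' : 0 ≤ cp := (frob_nonneg _).trans hcp0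
  have hsR : 1 ≤ √(R : ℝ) := Real.one_le_sqrt.mpr (by exact_mod_cast hR1)
  have hε' : 0 ≤ √(R : ℝ) * ε := by positivity
  have hT' : ∀ h k, h ≤ L → k < 2 ^ (L - h) → (sk.T h k)ᵀ * sk.T h k = 1 := fun h k hh hk => by
    obtain hlt | rfl := hh.lt_or_eq
    · exact hT h k hlt hk
    · obtain rfl : k = 0 := by simpa using hk
      exact sk.T_root_orthonormal
  have hcp'' : ∀ h k, h ≤ L → k < 2 ^ (L - h) → frobM (sk.sketched q h k) ≤ cp :=
    fun h k hh hk => (sk.frobM_sketched_le (hT' h k hh hk) q).trans hcp0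
  have hrankA : ∀ h k, h < L → k < 2 ^ (L - h) → (sk.A q h k).rank ≤ sk.r h := fun h k hh hk =>
    (Matrix.rank_mul_le_right _ _).trans ((Matrix.rank_mul_le_left _ _).trans (hrank h k hh hk))
  have hr1 : ∀ h, h < L → 1 ≤ sk.r h := fun h hh => by
    have hk : 0 < 2 ^ (L - h) := by positivity
    refine Nat.one_le_iff_ne_zero.mpr fun h0 => (hcap h 0 hh hk).A_ne_zero hq ?_
    have := hrankA h 0 hh hk
    rw [h0, Nat.le_zero] at this
    exact eq_zero_of_rank_eq_zero this
  have hleaf := one_le_specNorm_mul_of_isMoorePenrose (pinv_isMoorePenrose (sk.A q 0 0))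
    ((hcap 0 0 hL h00).A_ne_zero hq)
  have hleafA : 1 ≤ cA * frobM (sk.sketched q 0 0) :=
    hleaf.trans (mul_le_mul (hcA 0 0 hL h00) (Sketch.specNorm_A_le (hS 0 0 hL h00) q)
      (specNorm_nonneg _) hcA0)
  have hcAcp : 1 ≤ cA * cp := hleafA.trans (mul_le_mul_of_nonneg_left (hcp 0 0 hL h00) hcA0)
  -- At a leaf the recovered function is the sketched input, within `ε` of the exact one, so `cpt`
  -- cannot be much smaller than `1 / cA`.
  have hcAcpt : 1 - cA * ε ≤ cA * cpt := by
    have h1 : frobM (sk.sketched q 0 0) ≤ cpt + ε := by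
      refine (frobM_le_add_frobM_sub _ (sk.sketched p 0 0)).trans
        (add_le_add (hcpt 0 0 hL h00) ?_)
      rw [frobM_sub_comm, Sketch.sketched_sub]
      exact (sk.frobM_sketched_le (hT 0 0 hL h00) _).trans hε
    have := mul_le_mul_of_nonneg_left h1 hcA0
    linarith
  set g := growth cA cp cpt with hgdef
  set D := cpt ^ 2 * (cAhat ^ 2 + 6 * cA * cAhat ^ 2 * cp + 6 * cA ^ 2 * cAhat * cp) with hD
  have hD0 : 0 ≤ D := by positivity
  have hg1 : 0 < g - 1 := by linarith
  -- In units of `√R * ε` this solves the recursion e ↦ g e + D from e = 1. The factor `√R`, present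
  -- already at the leaves, is what the case of large `ε` consumes.
  have key : ∀ h, h ≤ L → ∀ k, k < 2 ^ (L - h) →
      frobM (t.recovered h k - sk.sketched q h k)
        ≤ (g ^ h + D * ((g ^ h - 1) / (g - 1))) * (√R * ε) := by
    intro h
    induction h with
    | zero =>
      intro _ k hk
      have h1 : frobM (t.recovered 0 k - sk.sketched q 0 k) ≤ ε := by
        change frobM (sk.sketched p 0 k - sk.sketched q 0 k) ≤ ε
        rw [Sketch.sketched_sub]
        exact (sk.frobM_sketched_le (hT 0 k hL hk) _).trans hε
      simpa using h1.trans (le_mul_of_one_le_left hε0 hsR)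
    | succ h ih =>
      intro hh k hk
      have hpow : 2 ^ (L - h) = 2 * 2 ^ (L - (h + 1)) := by
        rw [← pow_succ']; congr 1; omega
      have hgh : 1 ≤ g ^ h := one_le_pow₀ hg.le
      refine (t.frobM_recovered_succ_sub_le hh (by omega) (by omega) (fun k => hS h k hh)
        (fun k => hT h k hh) (hT' _ k hh hk) (fun k => hcap h k hh) (fun k => hrankA h k hh) hR1
        (hR h hh) (hr1 h hh) (fun k => hcA h k hh) (fun k => hcp h k hh) (hcp'' _ k hh hk)
        (fun k => hcAhat h k hh) (fun k => hcpt h k hh) hε hcAcp hcAcpt (ih (by omega)) ?_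
        (by linarith)).trans_eq ?_
      · refine le_mul_of_one_le_left hε' ?_
        have : 0 ≤ D * ((g ^ h - 1) / (g - 1)) :=
          mul_nonneg hD0 (div_nonneg (by linarith) hg1.le)
        linarith
      · rw [← hgdef, ← hD]
        field_simp
        ring
  rw [t.frob_output_sub]
  refine (key L le_rfl 0 (by simp)).trans (mul_le_mul_of_nonneg_right ?_ hε')
  have h1 : D * ((g ^ L - 1) / (g - 1)) ≤ D / (g - 1) * g ^ L := by
    rw [mul_div_assoc', div_mul_eq_mul_div]
    gcongr
    linarith
  linarith

theorem exp_four_thirds_le_four : Real.exp (4 / 3) ≤ 4 := by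
  refine le_of_pow_le_pow_left₀ (n := 3) (by norm_num) (by norm_num) ?_
  rw [← Real.exp_nat_mul]
  have h1 : ((3 : ℕ) : ℝ) * (4 / 3) = (4 : ℕ) * 1 := by norm_num
  rw [h1, Real.exp_nat_mul]
  calc Real.exp 1 ^ 4 ≤ 2.72 ^ 4 :=
        pow_le_pow_left₀ (Real.exp_pos _).le (Real.exp_one_lt_d9.le.trans (by norm_num)) 4
    _ ≤ _ := by norm_num

end HierTN

/-! ### The bound with high probability -/

theorem theorem3 {L N : ℕ} (hL : 1 ≤ L) (hN : 1 ≤ N) (n : Fin (2 ^ L) → ℕ)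
    -- the true density
    (pstar : State n → ℝ) (hp_nonneg : ∀ x, 0 ≤ pstar x) (hp_sum : ∑ x, pstar x = 1)
    -- sketches with orthonormal columns
    (sk : Sketch L n)
    (hS : ∀ h k, h < L → k < 2 ^ (L - h) → (sk.S h k)ᵀ * sk.S h k = 1)
    (hT : ∀ h k, h < L → k < 2 ^ (L - h) → (sk.T h k)ᵀ * sk.T h k = 1)
    -- the ranks of the unfoldings of the true density
    (hr : ∀ h, h < L → sk.r h ≤ sk.rt h)
    (hrank : ∀ h k, h < L → k < 2 ^ (L - h) → (unfolding pstar h k).rank ≤ sk.r h)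
    -- the sketches capture the column and the row spaces of these unfoldings
    (hrangeT : ∀ h k, h < L → k < 2 ^ (L - h) →
      colRange (unfolding pstar h k * sk.T h k) = colRange (unfolding pstar h k))
    (hrangeS : ∀ h k, h < L → k < 2 ^ (L - h) →
      colRange ((unfolding pstar h k)ᵀ * sk.S h k) = colRange ((unfolding pstar h k)ᵀ))
    -- bounds for the true density
    (cA cp : ℝ)
    (hcA : ∀ h k, h < L → k < 2 ^ (L - h) → specNorm (pinv (sk.A pstar h k)) ≤ cA)
    (hcp : ∀ h k, h < L → k < 2 ^ (L - h) → frobM (sk.sketched pstar h k) ≤ cp)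
    (hcp0 : frob pstar ≤ cp)
    -- independent samples from the true density
    {Ω : Type*} [MeasurableSpace Ω] (μ : Measure Ω) [IsProbabilityMeasure μ]
    (Y : Fin N → Ω → State n) (hY_meas : ∀ j, Measurable (Y j))
    (hY_indep : iIndepFun Y μ)
    (hY_law : ∀ j x, μ.real {ω | Y j ω = x} = pstar x)
    (δ : ℝ) (hδ0 : 0 < δ) (hδ1 : δ < 1) :
    1 - δ ≤ μ.real {ω |
      ∀ (t : sk.Trimming (empirical fun j => Y j ω)) (cAhat cpt : ℝ),
        (∀ h k, h < L → k < 2 ^ (L - h) → specNorm (pinv (t.P h k)) ≤ cAhat) →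
        (∀ h k, h < L → k < 2 ^ (L - h) → frobM (t.recovered h k) ≤ cpt) →
        1 < growth cA cp cpt →
        frob (fun x => t.output x - pstar x) ≤
          errConst ((Finset.range L).sup sk.rt) cA cAhat cp cpt
            * growth cA cp cpt ^ Real.logb 2 (2 ^ L : ℝ)
            * (Real.log (2 * ((Finset.range L).sup sk.rt : ℕ) * (2 ^ L : ℝ)
                * Real.logb 2 (2 ^ L : ℝ) / δ) / Real.sqrt N)} := by
  set R := (Finset.range L).sup sk.rt with hRdef
  have hR : ∀ h, h < L → sk.rt h ≤ R := fun h hh => Finset.le_sup (Finset.mem_range.mpr hh)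
  have hq : pstar ≠ 0 := by
    rintro rfl
    simp at hp_sum
  have hr0 : 1 ≤ sk.r 0 := by
    refine Nat.one_le_iff_ne_zero.mpr fun h0 => hq ?_
    have h1 := hrank 0 0 hL (by positivity)
    rw [h0, Nat.le_zero] at h1
    have h2 := frobM_unfolding pstar 0 0
    rw [eq_zero_of_rank_eq_zero h1, frob_eq_norm] at h2
    have h3 : ‖WithLp.toLp 2 pstar‖ = 0 := by
      rw [← h2]; simp [frobM, frob]
    exact congrArg WithLp.ofLp (norm_eq_zero.mp h3)
  have hR1 : 1 ≤ R := hr0.trans ((hr 0 hL).trans (hR 0 hL))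
  have hlog : Real.logb 2 (2 ^ L : ℝ) = L := by
    rw [Real.logb_pow, Real.logb_self_eq_one one_lt_two, mul_one]
  rw [hlog]
  set u := Real.log (2 * (R : ℝ) * (2 ^ L : ℝ) * (L : ℝ) / δ) with hu
  have hprob := one_sub_exp_le_measureReal_frob_le hp_nonneg hp_sum hN μ Y hY_indep hY_law u
  -- The argument of the logarithm is at least `4 / δ`, because `R`, `L` ≥ 1 and `2 ^ L` ≥ 2, and 4
  -- exceeds `exp (4 / 3)`.
  have hexp : Real.exp (4 / 3 - u) ≤ δ := by
    have hR1' : (1 : ℝ) ≤ R := by exact_mod_cast hR1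
    have hL1 : (1 : ℝ) ≤ L := by exact_mod_cast hL
    have h2L : (2 : ℝ) ≤ 2 ^ L := le_self_pow₀ one_le_two (by omega)
    have h4 : (4 : ℝ) ≤ 2 * R * 2 ^ L * L := by
      calc (4 : ℝ) = 2 * 1 * 2 * 1 := by norm_num
        _ ≤ 2 * R * 2 ^ L * L := by gcongr
    rw [Real.exp_sub, hu, Real.exp_log (by positivity), div_le_iff₀ (by positivity),
      mul_div_cancel₀ _ hδ0.ne']
    exact exp_four_thirds_le_four.trans h4
  -- The good event concerns the sample alone and the rest is deterministic, so all trimmings and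
  -- all constants are covered at once.
  refine (sub_le_sub_left hexp 1).trans (hprob.trans (measureReal_mono fun ω hω => ?_))
  intro t cAhat cpt hcAhat hcpt hg
  have hmain := frob_output_sub_le hL hq sk hS hT hrank
    (fun h k hh hk => ⟨hrangeT h k hh hk, hrangeS h k hh hk⟩) hR1 hR hcA hcp hcp0 t hcAhat hcpt
    hω hg
  rw [Real.rpow_natCast, errConst]
  refine hmain.trans_eq ?_
  ring
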